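/- Let $Y_i=\mu_i+\sigma\varepsilon_i$, $i=1,\dots,n$, where $\mu\in\mathbb{R}^n$, $\sigma>0$ and $\varepsilon_1,\dots,\varepsilon_n$ are i.i.d. standard Gaussian; put $\theta=(\mu,\sigma^2)$. Let $\{S_m,\ m\in\mathcal M\}$ be a finite nonempty collection of linear subspaces of $\mathbb{R}^n$, $D_m=\dim S_m$, $N_m=n-D_m$, let $\Pi_m$ be the orthogonal projector onto $S_m$, and set $$\hat\theta_m=(\hat\mu_m,\hat\sigma_m^2)=\Bigl(\Pi_mY,\ \frac{\|Y-\Pi_mY\|^2}{N_m}\Bigr).$$ The Kullback loss between the Gaussian laws $P_{\mu,\sigma^2}=\mathcal N(\mu,\sigma^2I_n)$ and $P_{\nu,\tau^2}$ is $$\mathcal K(P_{\mu,\sigma^2},P_{\nu,\tau^2})=\frac n2\Bigl[\log\frac{\tau^2}{\sigma^2}+\frac{\sigma^2}{\tau^2}-1+\frac{\|\mu-\nu\|^2}{n\tau^2}\Bigr].$$ For integers $D\ge1$, $N\ge3$ and $x\ge0$ let $\mathrm{Fish}[D,N,x]=\mathbb E[(F_{D,N}-x)_+]/\mathbb E[F_{D,N}]$,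 where $F_{D,N}$ is a Fisher random variable with $D$ and $N$ degrees of freedom, and for $0<q\le1$ let $\mathrm{EFish}[D,N,q]\ge0$ be the solution of $\mathrm{Fish}[D,N,\mathrm{EFish}[D,N,q]]=q$. **Theorem 3.** Assume that $D_m\le n-5$ for all $m\in\mathcal M$. Let $K_2\ge K_1>1$, let $\mathrm{pen}^*:\mathcal M\to\mathbb R_+$, let $\alpha=\min_{m\in\mathcal M}N_m/n$, and let $\hat m$ be a random index which almost surely minimizes over $\mathcal M$ the criterion $$\mathrm{Crit}'_K(m)=\frac n2\log\Bigl(\frac{\|Y-\Pi_mY\|^2}{N_m}\Bigr)+\frac12\mathrm{pen}^*(m).$$ Then the losses $\mathcal K(P_\theta,P_{\hat\theta_m})$, $m\in\mathcal M$, and the loss of $\tilde\theta=\hat\theta_{\hat m}$ are integrable, and $$\mathbb E[\mathcal K(P_\theta,P_{\tilde\theta})]\le\frac{K_1}{K_1-1}\Bigl\{\inf_{m\in\mathcal M}\Bigl[\mathbb E[\mathcal K(P_\theta,P_{\hat\theta_m})]+\frac94\bigl(\mathrm{pen}^*(m)\vee D_m\bigr)\Bigr]+\Sigma_1+\Sigma_2\Bigr\},$$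 where $$\Sigma_1=2.5\,e^{1/(K_2^2\alpha)}\,n\,e^{-n/(4K_2^2)}\,|\mathcal M|^{4/(\alpha n)},\qquad \Sigma_2=\frac{5K_1}{4}\sum_{m\in\mathcal M}(D_m+1)\Lambda_m,$$ $$\Lambda_m=\mathrm{Fish}\Bigl[D_m+1,\ N_m-1,\ \frac{N_m-1}{K_1N_m}\cdot\frac{K_2D_m+(K_2-1)\mathrm{pen}^*(m)}{K_2(D_m+1)}\Bigr].$$ In particular, if $(L_m)_{m\in\mathcal M}$ are nonnegative numbers and, for all $m\in\mathcal M$, $$\mathrm{pen}^*(m)=\mathrm{pen}^{\mathcal K}_{K_1,K_2,\mathcal L}(m)=\frac{K_2}{K_2-1}\Bigl[\frac{K_1(D_m+1)N_m}{N_m-1}\,\mathrm{EFish}\bigl[D_m+1,N_m-1,e^{-L_m}\bigr]-D_m\Bigr]_+,$$ then the bound above holds with $\Sigma_2\le1.25\,K_1\sum_{m\in\mathcal M}(D_m+1)e^{-L_m}$. -/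

import Mathlib

open MeasureTheory ProbabilityTheory

noncomputable section

namespace KullbackSelection

/-- The χ² distribution with `k` degrees of freedom: the law of the sum of the squares of `k`
independent standard Gaussian variables. -/
def chiSquared (k : ℕ) : Measure ℝ :=
  (stdGaussian (EuclideanSpace ℝ (Fin k))).map (fun x => ‖x‖ ^ 2)

/-- The Fisher distribution with `D` and `N` degrees of freedom: the law of `(U / D) / (V / N)`
for independent `U`, `V` with χ² distributions with `D` and `N` degrees of freedom. -/
def fisherLaw (D N : ℕ) : Measure ℝ :=
  ((chiSquared D).prod (chiSquared N)).map (fun p => (p.1 / D) / (p.2 / N))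

/-- `Fish[D, N, x] = E[(F - x)₊] / E[F]` for a Fisher variable `F` with `D` and `N` degrees of
freedom (meaningful for `D ≥ 1` and `N ≥ 3`, so that `F` is integrable). -/
def Fish (D N : ℕ) (x : ℝ) : ℝ :=
  (∫ t, max (t - x) 0 ∂(fisherLaw D N)) / ∫ t, t ∂(fisherLaw D N)

open Classical in
/-- `EFish[D, N, q]` is the solution `x ≥ 0` of `Fish[D, N, x] = q` for `0 < q ≤ 1`. It is `0` by
convention for `q > 1`, where there is no solution. -/
def EFish (D N : ℕ) (q : ℝ) : ℝ :=
  if h : q ≤ 1 ∧ ∃ x : ℝ, 0 ≤ x ∧ Fish D N x = q then h.2.choose else 0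

/-- The Kullback loss `𝒦(P_{μ, s}, P_{ν, t})`, where `P_{μ, s}` is the Gaussian law on `ℝⁿ` with
mean `μ` and covariance matrix `s I` (the arguments `s` and `t` are variances). -/
def kullback {n : ℕ} (θ θ' : EuclideanSpace ℝ (Fin n) × ℝ) : ℝ :=
  (n : ℝ) / 2 * (Real.log (θ'.2 / θ.2) + θ.2 / θ'.2 - 1 + ‖θ.1 - θ'.1‖ ^ 2 / (n * θ'.2))

/-- The dimension `D` of a model. -/
def dimD {n : ℕ} (S : Submodule ℝ (EuclideanSpace ℝ (Fin n))) : ℕ := Module.finrank ℝ S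

/-- The codimension `N = n - D` of a model. -/
def codimN {n : ℕ} (S : Submodule ℝ (EuclideanSpace ℝ (Fin n))) : ℕ := n - dimD S

/-- The variance estimator `‖y - Π y‖² / N` on the model `S`. -/
def sigmaHatSq {n : ℕ} (S : Submodule ℝ (EuclideanSpace ℝ (Fin n)))
    (y : EuclideanSpace ℝ (Fin n)) : ℝ :=
  ‖y - S.starProjection y‖ ^ 2 / (codimN S : ℝ)

/-- The estimator `(Π y, ‖y - Π y‖² / N)` of the pair (mean, variance) on the model `S`. -/
def thetaHat {n : ℕ} (S : Submodule ℝ (EuclideanSpace ℝ (Fin n)))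
    (y : EuclideanSpace ℝ (Fin n)) : EuclideanSpace ℝ (Fin n) × ℝ :=
  (S.starProjection y, sigmaHatSq S y)

/-- The criterion `(n / 2) log (‖y - Π y‖² / N) + p / 2` of the model `S` with penalty `p`. -/
def critK {n : ℕ} (S : Submodule ℝ (EuclideanSpace ℝ (Fin n))) (p : ℝ)
    (y : EuclideanSpace ℝ (Fin n)) : ℝ :=
  (n : ℝ) / 2 * Real.log (‖y - S.starProjection y‖ ^ 2 / (codimN S : ℝ)) + 1 / 2 * p

/-- `α = min {N_m / n}` (over a finite nonempty index set). -/
def alphaMin {n : ℕ} {M : Type*} (S : M → Submodule ℝ (EuclideanSpace ℝ (Fin n))) : ℝ :=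
  ⨅ m, (codimN (S m) : ℝ) / n

/-- The residual term `Σ₁`. -/
def Sigma1 {n : ℕ} {M : Type*} [Fintype M] (S : M → Submodule ℝ (EuclideanSpace ℝ (Fin n)))
    (K₂ : ℝ) : ℝ :=
  2.5 * Real.exp (1 / (K₂ ^ 2 * alphaMin S)) * n * Real.exp (-(n : ℝ) / (4 * K₂ ^ 2)) *
    (Fintype.card M : ℝ) ^ (4 / (alphaMin S * n))

/-- The quantity `Λ_m` of the model `S` with penalty `p`. -/
def Lambda {n : ℕ} (S : Submodule ℝ (EuclideanSpace ℝ (Fin n))) (K₁ K₂ p : ℝ) : ℝ :=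
  Fish (dimD S + 1) (codimN S - 1)
    (((codimN S : ℝ) - 1) / (K₁ * codimN S) *
      ((K₂ * dimD S + (K₂ - 1) * p) / (K₂ * (dimD S + 1))))

/-- The residual term `Σ₂`. -/
def Sigma2 {n : ℕ} {M : Type*} [Fintype M] (S : M → Submodule ℝ (EuclideanSpace ℝ (Fin n)))
    (K₁ K₂ : ℝ) (pen : M → ℝ) : ℝ :=
  5 * K₁ / 4 * ∑ m, ((dimD (S m) : ℝ) + 1) * Lambda (S m) K₁ K₂ (pen m)

/-- The penalty of the model `S` built from `EFish` with weight `L`. -/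
def penK {n : ℕ} (S : Submodule ℝ (EuclideanSpace ℝ (Fin n))) (K₁ K₂ L : ℝ) : ℝ :=
  K₂ / (K₂ - 1) *
    max (K₁ * (dimD S + 1) * codimN S / ((codimN S : ℝ) - 1) *
      EFish (dimD S + 1) (codimN S - 1) (Real.exp (-L)) - dimD S) 0

end KullbackSelection

end

/-! Work on the noise space. For a model put y = σ²/σ̂² (`varRatio`) and X = ‖x‖² for the noise x;
let v be the squared norm of the rescaled bias, s = ‖Πx‖² and c = ⟨bias, x⟩. The loss is n/2 (y - 1
- log y) + y(v + s)/2 and, up to a constant, the criterion is -(n/2) log y + pen/2. The definition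
of σ̂² gives y(v + 2c + X - s) = N, which turns the loss into -(n/2) log y + (n - X)y/2 - D/2 + y(s
- c). Its first term is what the criterion controls, so comparing the selected model (primed) with a
fixed one leaves three kinds of error.

The cross term y'(s' - c') of the selected model is handled by enlarging each S to T containing S
and μ, with dim T = D + 1. The bias lies in T, so Young's inequality gives 2(s' - c') ≤ (v' + s')/K₁
+ K₁‖T'x‖² (`two_mul_cross_term_le`). The first part is absorbed by the loss, whence the factor
K₁/(K₁ - 1). In the second, y' ≤ N'/‖T'ᗮx‖² and Cochran's theorem produce a Fisher ratio with D' + 1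
and N' - 1 degrees of freedom. What the penalty leaves of it is summed over all models, which yields
Σ₂ (`integral_excess_le`).

The factor n - X multiplies y' - y. Giving up a share 1/K₂ of the nonnegative function y' - 1 - log
y' makes the coefficient of y - y' proportional to n/K₂ - (n - X). If it is positive, y - y' ≤ y
log(y/y') ≤ y pen/n by the criterion; otherwise the noise is atypically small, an event of
probability at most exp(-n/(4K₂²)), and Hölder's inequality with moments of inverse χ² variables
yields Σ₁ (`noise_term_le`, `integral_smallNoise_le`).

The cross term yc of the fixed model has nonpositive mean by the symmetry x ↦ -x
(`integral_varRatio_mul_inner_bias_nonpos`). These pieces are assembled pointwise in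
`loss_comparison` and integrated in `integral_lossBound_le`. The bound for the `EFish` penalty then
follows from the monotonicity of `Fish`. -/

namespace KullbackSelection

/-! ### Density, Laplace transform and radial moments of the standard Gaussian law -/

section Gaussian

/-- The density of the standard Gaussian measure with respect to the volume, as a function of the
norm, in dimension `d`. -/
noncomputable def stdGaussianRadialPDF (d : ℕ) (r : ℝ) : ℝ :=
  (2 * Real.pi) ^ (-(d : ℝ) / 2) * Real.exp (-(1 / 2) * r ^ 2)

lemma stdGaussianRadialPDF_pos (d : ℕ) (r : ℝ) : 0 < stdGaussianRadialPDF d r := by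
  unfold stdGaussianRadialPDF
  positivity

lemma measurable_stdGaussianRadialPDF (d : ℕ) : Measurable (stdGaussianRadialPDF d) := by
  unfold stdGaussianRadialPDF
  fun_prop

lemma measurable_ofReal_stdGaussianRadialPDF_norm {E : Type*} [NormedAddCommGroup E]
    [MeasurableSpace E] [BorelSpace E] (d : ℕ) :
    Measurable (fun x : E => ENNReal.ofReal (stdGaussianRadialPDF d ‖x‖)) :=
  ((measurable_stdGaussianRadialPDF d).comp measurable_norm).ennreal_ofReal

variable {E : Type*} [NormedAddCommGroup E] [InnerProductSpace ℝ E] [FiniteDimensional ℝ E]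
  [MeasurableSpace E] [BorelSpace E]

lemma integrable_exp_neg_mul_sq_norm {b : ℝ} (hb : 0 < b) :
    Integrable (fun x : E => Real.exp (-b * ‖x‖ ^ 2)) := by
  have h := GaussianFourier.integrable_cexp_neg_mul_sq_norm_add (b := (b : ℂ)) (V := E)
    (by simpa using hb) 0 0
  refine h.norm.congr (.of_forall fun x => ?_)
  simp only [Complex.norm_exp]
  congr 1
  norm_cast
  simp

/-- The standard Gaussian measure has the usual density. -/
lemma stdGaussian_eq_withDensity :
    stdGaussian E = (volume : Measure E).withDensity
      (fun x => ENNReal.ofReal (stdGaussianRadialPDF (Module.finrank ℝ E) ‖x‖)) := by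
  have hKint : Integrable (fun x : E => stdGaussianRadialPDF (Module.finrank ℝ E) ‖x‖) :=
    (integrable_exp_neg_mul_sq_norm (by norm_num)).const_mul _
  have : IsFiniteMeasure ((volume : Measure E).withDensity
      (fun x => ENNReal.ofReal (stdGaussianRadialPDF (Module.finrank ℝ E) ‖x‖))) :=
    isFiniteMeasure_withDensity_ofReal hKint.2
  apply Measure.ext_of_charFun
  ext t
  rw [charFun_stdGaussian, charFun_apply, integral_withDensity_eq_integral_toReal_smul
    (measurable_ofReal_stdGaussianRadialPDF_norm _)
    (.of_forall fun x => ENNReal.ofReal_lt_top)]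
  have h := GaussianFourier.integral_cexp_neg_mul_sq_norm_add (b := ((1 / 2 : ℝ) : ℂ)) (V := E)
    (by simp only [Complex.ofReal_re]; norm_num) Complex.I t
  have h2 : ∀ x : E, (ENNReal.ofReal (stdGaussianRadialPDF (Module.finrank ℝ E) ‖x‖)).toReal •
      Complex.exp (inner ℝ x t * Complex.I) =
      (((2 * Real.pi) ^ (-(Module.finrank ℝ E : ℝ) / 2) : ℝ) : ℂ) *
      Complex.exp (-((1 / 2 : ℝ) : ℂ) * ‖x‖ ^ 2 + Complex.I * inner ℝ t x) := by
    intro x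
    rw [ENNReal.toReal_ofReal (stdGaussianRadialPDF_pos _ _).le, Complex.real_smul,
      stdGaussianRadialPDF, Complex.ofReal_mul, mul_assoc, Complex.ofReal_exp, ← Complex.exp_add,
      real_inner_comm]
    push_cast
    ring_nf
  simp_rw [h2]
  rw [integral_const_mul, h, ← mul_assoc]
  have h3 : (((2 * Real.pi) ^ (-(Module.finrank ℝ E : ℝ) / 2) : ℝ) : ℂ) *
      (Real.pi / ((1 / 2 : ℝ) : ℂ)) ^ ((Module.finrank ℝ E : ℂ) / 2) = 1 := by
    have e1 : (Real.pi / ((1 / 2 : ℝ) : ℂ)) ^ ((Module.finrank ℝ E : ℂ) / 2) =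
        (((2 * Real.pi) ^ ((Module.finrank ℝ E : ℝ) / 2) : ℝ) : ℂ) := by
      rw [Complex.ofReal_cpow (by positivity)]
      push_cast
      congr 1
      ring
    rw [e1, ← Complex.ofReal_mul, ← Real.rpow_add (by positivity)]
    simp [neg_div]
  rw [h3, one_mul, Complex.I_sq]
  congr 1
  push_cast
  ring

lemma integral_stdGaussian_norm (f : ℝ → ℝ) :
    ∫ x, f ‖x‖ ∂(stdGaussian E) =
      ∫ x : E, stdGaussianRadialPDF (Module.finrank ℝ E) ‖x‖ * f ‖x‖ := by
  rw [stdGaussian_eq_withDensity, integral_withDensity_eq_integral_toReal_smul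
    (measurable_ofReal_stdGaussianRadialPDF_norm _)
    (.of_forall fun x => ENNReal.ofReal_lt_top)]
  simp_rw [ENNReal.toReal_ofReal (stdGaussianRadialPDF_pos _ _).le, smul_eq_mul]

lemma integrable_stdGaussian_norm (f : ℝ → ℝ) :
    Integrable (fun x => f ‖x‖) (stdGaussian E) ↔
      Integrable (fun x : E => stdGaussianRadialPDF (Module.finrank ℝ E) ‖x‖ * f ‖x‖) := by
  rw [stdGaussian_eq_withDensity, integrable_withDensity_iff_integrable_smul'
    (measurable_ofReal_stdGaussianRadialPDF_norm _)
    (.of_forall fun x => ENNReal.ofReal_lt_top)]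
  simp_rw [ENNReal.toReal_ofReal (stdGaussianRadialPDF_pos _ _).le, smul_eq_mul]

lemma stdGaussian_absolutelyContinuous : stdGaussian E ≪ (volume : Measure E) := by
  rw [stdGaussian_eq_withDensity]
  exact withDensity_absolutelyContinuous _ _

/-- The Laplace transform of the squared norm of a standard Gaussian vector. -/
lemma integral_exp_neg_mul_sq_norm_stdGaussian {l : ℝ} (hl : 0 ≤ l) :
    Integrable (fun x => Real.exp (-l * ‖x‖ ^ 2)) (stdGaussian E) ∧
    ∫ x, Real.exp (-l * ‖x‖ ^ 2) ∂(stdGaussian E) =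
      (1 + 2 * l) ^ (-(Module.finrank ℝ E : ℝ) / 2) := by
  have e : ∀ x : E, stdGaussianRadialPDF (Module.finrank ℝ E) ‖x‖ * Real.exp (-l * ‖x‖ ^ 2) =
      (2 * Real.pi) ^ (-(Module.finrank ℝ E : ℝ) / 2) *
        Real.exp (-(1 / 2 + l) * ‖x‖ ^ 2) := by
    intro x
    rw [stdGaussianRadialPDF, mul_assoc, ← Real.exp_add]
    ring_nf
  constructor
  · rw [integrable_stdGaussian_norm (fun r => Real.exp (-l * r ^ 2))]
    simp_rw [e]
    exact (integrable_exp_neg_mul_sq_norm (by positivity)).const_mul _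
  rw [integral_stdGaussian_norm (fun r => Real.exp (-l * r ^ 2))]
  simp_rw [e]
  rw [integral_const_mul, GaussianFourier.integral_rexp_neg_mul_sq_norm (by positivity), neg_div,
    Real.rpow_neg (by positivity), Real.rpow_neg (by positivity), ← Real.inv_rpow (by positivity),
    ← Real.inv_rpow (by positivity), ← Real.mul_rpow (by positivity) (by positivity)]
  congr 1
  field_simp

/-- Lower deviations of the squared norm of a standard Gaussian vector. -/
lemma stdGaussian_sq_norm_le {t : ℝ} (ht : 0 ≤ t) :
    (stdGaussian E).real {x | ‖x‖ ^ 2 ≤ (Module.finrank ℝ E : ℝ) * (1 - t)} ≤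
      Real.exp (-(Module.finrank ℝ E : ℝ) * t ^ 2 / 4) := by
  -- Chernoff's bound with parameter t/2: not optimal, but it gives exactly the exponent -d t²/4
  -- once log(1 + t) ≥ t - t²/2 is used.
  obtain ⟨hi, he⟩ := integral_exp_neg_mul_sq_norm_stdGaussian (E := E) (l := t / 2) (by positivity)
  set d : ℝ := (Module.finrank ℝ E : ℝ)
  have hm := mul_meas_ge_le_integral_of_nonneg
    (.of_forall fun x => (Real.exp_pos (-(t / 2) * ‖x‖ ^ 2)).le) hi
    (Real.exp (-(t / 2) * (d * (1 - t))))
  rw [he] at hm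
  have hsub : (stdGaussian E).real {x | ‖x‖ ^ 2 ≤ d * (1 - t)} ≤ (stdGaussian E).real
      {x | Real.exp (-(t / 2) * (d * (1 - t))) ≤ Real.exp (-(t / 2) * ‖x‖ ^ 2)} := by
    refine measureReal_mono fun x hx => ?_
    simp only [Set.mem_ofPred_eq, Real.exp_le_exp] at hx ⊢
    nlinarith
  have h1 : (1 + 2 * (t / 2)) ^ (-d / 2) ≤ Real.exp (-(d / 2) * (t - t ^ 2 / 2)) := by
    rw [Real.rpow_def_of_pos (by positivity)]
    apply Real.exp_le_exp.2
    have h2 : t - t ^ 2 / 2 ≤ Real.log (1 + 2 * (t / 2)) := by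
      have h3 := Real.le_log_one_add_of_nonneg ht
      have h4 : t - t ^ 2 / 2 ≤ 2 * t / (t + 2) := by
        rw [le_div_iff₀ (by positivity)]
        nlinarith [pow_nonneg ht 3]
      have h5 : 1 + 2 * (t / 2) = 1 + t := by ring
      rw [h5]
      linarith
    have hd : 0 ≤ d := by positivity
    nlinarith
  have h6 : (stdGaussian E).real {x | ‖x‖ ^ 2 ≤ d * (1 - t)} ≤
      Real.exp (-(d / 2) * (t - t ^ 2 / 2)) / Real.exp (-(t / 2) * (d * (1 - t))) := by
    rw [le_div_iff₀ (Real.exp_pos _), mul_comm]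
    exact (mul_le_mul_of_nonneg_left hsub (Real.exp_pos _).le).trans (hm.trans h1)
  refine h6.trans_eq ?_
  rw [← Real.exp_sub]
  ring_nf

/-- Moments of the norm of a standard Gaussian vector, of any real order. -/
lemma integral_rpow_norm_stdGaussian [Nontrivial E] {s : ℝ}
    (hs : s < (Module.finrank ℝ E : ℝ) / 2) :
    Integrable (fun x => (‖x‖ ^ 2) ^ (-s)) (stdGaussian E) ∧
    ∫ x, (‖x‖ ^ 2) ^ (-s) ∂(stdGaussian E) =
      2 ^ (-s) * Real.Gamma ((Module.finrank ℝ E : ℝ) / 2 - s) /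
        Real.Gamma ((Module.finrank ℝ E : ℝ) / 2) := by
  set d : ℕ := Module.finrank ℝ E with hd_def
  have hd : 1 ≤ d := Module.finrank_pos
  -- In polar coordinates every moment is the same constant times (1/2)^a Γ(d/2 - a); the constant
  -- is then identified by the case a = 0, where the integral is the total mass 1. The volume of the
  -- unit ball is never needed.
  have key : ∀ a : ℝ, a < (d : ℝ) / 2 →
      Integrable (fun x => (‖x‖ ^ 2) ^ (-a)) (stdGaussian E) ∧
      ∫ x, (‖x‖ ^ 2) ^ (-a) ∂(stdGaussian E) =
        ((d : ℝ) * (volume : Measure E).real (Metric.ball 0 1) *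
          (2 * Real.pi) ^ (-(d : ℝ) / 2) * (1 / 2) ^ (-(d : ℝ) / 2) / 2) *
          ((1 / 2) ^ a * Real.Gamma ((d : ℝ) / 2 - a)) := by
    intro a ha
    have e : ∀ y ∈ Set.Ioi (0 : ℝ), y ^ (d - 1) • (stdGaussianRadialPDF d y * (y ^ 2) ^ (-a)) =
        (2 * Real.pi) ^ (-(d : ℝ) / 2) *
          (y ^ ((d : ℝ) - 1 - 2 * a) * Real.exp (-(1 / 2) * y ^ (2 : ℝ))) := by
      intro y hy
      have hy : 0 < y := hy
      rw [stdGaussianRadialPDF, smul_eq_mul]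
      have e1 : y ^ ((d : ℝ) - 1 - 2 * a) = y ^ (d - 1) * (y ^ 2) ^ (-a) := by
        rw [← Real.rpow_natCast y (d - 1), ← Real.rpow_natCast y 2, ← Real.rpow_mul hy.le,
          ← Real.rpow_add hy]
        congr 1
        push_cast [Nat.cast_sub hd]
        ring
      rw [e1, Real.rpow_two]
      ring
    have ha' : -1 < (d : ℝ) - 1 - 2 * a := by linarith
    constructor
    · rw [integrable_stdGaussian_norm (fun r => (r ^ 2) ^ (-a)), ← hd_def,
        integrable_fun_norm_addHaar volume
          (f := fun r => stdGaussianRadialPDF d r * (r ^ 2) ^ (-a)), ← hd_def]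
      rw [integrableOn_congr_fun e measurableSet_Ioi]
      exact (integrableOn_rpow_mul_exp_neg_mul_rpow ha' (by norm_num) (by norm_num)).const_mul _
    · rw [integral_stdGaussian_norm (fun r => (r ^ 2) ^ (-a)), ← hd_def,
        integral_fun_norm_addHaar volume
          (f := fun r => stdGaussianRadialPDF d r * (r ^ 2) ^ (-a)), ← hd_def]
      rw [setIntegral_congr_fun measurableSet_Ioi e, integral_const_mul,
        integral_rpow_mul_exp_neg_mul_rpow (by norm_num) ha' (by norm_num)]
      have e2 : (1 / 2 : ℝ) ^ (-((d : ℝ) - 1 - 2 * a + 1) / 2) =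
          (1 / 2) ^ (-(d : ℝ) / 2) * (1 / 2) ^ a := by
        rw [← Real.rpow_add (by norm_num)]
        congr 1
        ring
      have e3 : ((d : ℝ) - 1 - 2 * a + 1) / 2 = (d : ℝ) / 2 - a := by ring
      rw [e2, e3, nsmul_eq_mul, smul_eq_mul]
      ring
  have hd0 : (0 : ℝ) < (d : ℝ) / 2 := by positivity
  have h0 := (key 0 hd0).2
  simp only [neg_zero, Real.rpow_zero, integral_const, probReal_univ, smul_eq_mul, one_mul,
    sub_zero] at h0
  refine ⟨(key s hs).1, ?_⟩
  rw [(key s hs).2, eq_div_iff (Real.Gamma_pos_of_pos hd0).ne']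
  have e4 : (2 : ℝ) ^ (-s) = (1 / 2) ^ s := by
    rw [Real.rpow_neg (by norm_num), ← Real.inv_rpow (by norm_num)]
    norm_num
  rw [e4]
  linear_combination (-((1 / 2) ^ s * Real.Gamma ((d : ℝ) / 2 - s))) * h0

/-- Log-convexity of the Gamma function gives `Γ (x + s) ≥ x ^ s Γ x` for `s ≥ 1`. -/
lemma rpow_mul_Gamma_le_Gamma_add {x s : ℝ} (hx : 0 < x) (hs : 1 ≤ s) :
    x ^ s * Real.Gamma x ≤ Real.Gamma (x + s) := by
  have hG := Real.Gamma_pos_of_pos hx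
  have hGs : 0 < Real.Gamma (x + s) := Real.Gamma_pos_of_pos (by linarith)
  have hs0 : 0 < s := by linarith
  have h := Real.convexOn_log_Gamma.2 (Set.mem_Ioi.2 hx)
    (Set.mem_Ioi.2 (by linarith : 0 < x + s))
    (show 0 ≤ 1 - 1 / s by rw [sub_nonneg, div_le_one hs0]; exact hs)
    (show 0 ≤ 1 / s by positivity) (by ring)
  have e : (1 - 1 / s) • x + (1 / s) • (x + s) = x + 1 := by
    simp only [smul_eq_mul]
    field_simp
    ring
  rw [e] at h
  simp only [Function.comp, smul_eq_mul] at h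
  rw [Real.Gamma_add_one hx.ne', Real.log_mul hx.ne' hG.ne'] at h
  have h2 : s * Real.log x + Real.log (Real.Gamma x) ≤ Real.log (Real.Gamma (x + s)) := by
    have h3 := mul_le_mul_of_nonneg_left h hs0.le
    have h4 : s * ((1 - 1 / s) * Real.log (Real.Gamma x) +
        1 / s * Real.log (Real.Gamma (x + s))) =
        (s - 1) * Real.log (Real.Gamma x) + Real.log (Real.Gamma (x + s)) := by
      field_simp
    linarith
  rw [← Real.log_le_log_iff (by positivity) hGs, Real.log_mul (by positivity) hG.ne',
    Real.log_rpow hx]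
  exact h2

end Gaussian

/-! ### χ² laws: Cochran's theorem and moments -/

section ChiSquared

instance (k : ℕ) : IsProbabilityMeasure (chiSquared k) :=
  Measure.isProbabilityMeasure_map (by fun_prop)

lemma stdGaussian_map_sq_norm {E : Type*} [NormedAddCommGroup E] [InnerProductSpace ℝ E]
    [FiniteDimensional ℝ E] [MeasurableSpace E] [BorelSpace E] :
    (stdGaussian E).map (fun x => ‖x‖ ^ 2) = chiSquared (Module.finrank ℝ E) := by
  rw [chiSquared, ← stdGaussian_map (stdOrthonormalBasis ℝ E).repr,
    Measure.map_map (by fun_prop) (LinearIsometryEquiv.continuous _).measurable]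
  congr 1
  ext x
  simp

/-- The standard Gaussian measure on an orthogonal sum is a product. -/
lemma stdGaussian_map_orthogonalProjectionOnto {E : Type*} [NormedAddCommGroup E]
    [InnerProductSpace ℝ E] [FiniteDimensional ℝ E] [MeasurableSpace E] [BorelSpace E]
    (T : Submodule ℝ E) :
    (stdGaussian E).map
        (fun x => (T.orthogonalProjectionOnto x, Tᗮ.orthogonalProjectionOnto x)) =
      (stdGaussian T).prod (stdGaussian Tᗮ) := by
  have h1 : (stdGaussian E).map T.orthogonalDecomposition =
      ((stdGaussian T).prod (stdGaussian Tᗮ)).map (WithLp.toLp 2) := by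
    rw [stdGaussian_map]
    apply Measure.ext_of_charFun
    ext t
    rw [charFun_prod, charFun_stdGaussian, charFun_stdGaussian, charFun_stdGaussian,
      ← Complex.exp_add]
    congr 1
    have := WithLp.prod_norm_sq_eq_of_L2 t
    norm_cast
    rw [this]
    simp only [WithLp.fst, WithLp.snd]
    ring
  have h2 := congrArg (Measure.map (WithLp.ofLp)) h1
  rw [Measure.map_map (by fun_prop) (LinearIsometryEquiv.continuous _).measurable,
    Measure.map_map (by fun_prop) (by fun_prop)] at h2
  have e : (WithLp.ofLp ∘ WithLp.toLp 2 : T × Tᗮ → T × Tᗮ) = id := rfl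
  rw [e, Measure.map_id] at h2
  rw [← h2]
  congr 1
  ext x <;> simp

/-- Cochran's theorem for two complementary orthogonal subspaces. -/
lemma stdGaussian_map_sq_norm_starProjection {E : Type*} [NormedAddCommGroup E]
    [InnerProductSpace ℝ E] [FiniteDimensional ℝ E] [MeasurableSpace E] [BorelSpace E]
    (T : Submodule ℝ E) :
    (stdGaussian E).map
        (fun x => (‖T.starProjection x‖ ^ 2, ‖Tᗮ.starProjection x‖ ^ 2)) =
      (chiSquared (Module.finrank ℝ T)).prod (chiSquared (Module.finrank ℝ Tᗮ)) := by
  rw [← stdGaussian_map_sq_norm, ← stdGaussian_map_sq_norm,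
    Measure.map_prod_map _ _ (by fun_prop) (by fun_prop),
    ← stdGaussian_map_orthogonalProjectionOnto, Measure.map_map (by fun_prop) (by fun_prop)]
  rfl

lemma ae_nonneg_chiSquared (k : ℕ) : ∀ᵐ v ∂(chiSquared k), 0 ≤ v := by
  rw [chiSquared, ae_map_iff (by fun_prop) measurableSet_Ici]
  exact .of_forall fun x => by positivity

lemma ae_pos_chiSquared {k : ℕ} (hk : 1 ≤ k) : ∀ᵐ v ∂(chiSquared k), 0 < v := by
  rw [chiSquared, ae_map_iff (by fun_prop) measurableSet_Ioi]
  have : Nonempty (Fin k) := ⟨⟨0, hk⟩⟩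
  have h : ∀ᵐ x ∂(stdGaussian (EuclideanSpace ℝ (Fin k))), x ≠ 0 :=
    stdGaussian_absolutelyContinuous.ae_le (Measure.ae_ne volume 0)
  filter_upwards [h] with x hx
  have := norm_pos_iff.2 hx
  positivity

lemma integral_rpow_chiSquared {k : ℕ} (hk : 1 ≤ k) {s : ℝ} (hs : s < (k : ℝ) / 2) :
    Integrable (fun v => v ^ (-s)) (chiSquared k) ∧
    ∫ v, v ^ (-s) ∂(chiSquared k) =
      2 ^ (-s) * Real.Gamma ((k : ℝ) / 2 - s) / Real.Gamma ((k : ℝ) / 2) := by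
  have : Nonempty (Fin k) := ⟨⟨0, hk⟩⟩
  have h := integral_rpow_norm_stdGaussian (E := EuclideanSpace ℝ (Fin k)) (s := s) (by simpa)
  rw [finrank_euclideanSpace_fin] at h
  rw [chiSquared, integrable_map_measure (by fun_prop) (by fun_prop),
    integral_map (by fun_prop) (by fun_prop)]
  exact h

/-- Apply Γ(x + s) ≥ x^s Γ(x) at x = k/2 - s. This replaces a ratio of Gamma functions by a bound
that can be made uniform over the models. -/
lemma integral_rpow_neg_chiSquared_le {k : ℕ} {s : ℝ} (hs1 : 1 ≤ s) (hs : s < (k : ℝ) / 2) :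
    ∫ v, v ^ (-s) ∂(chiSquared k) ≤ ((k : ℝ) - 2 * s) ^ (-s) := by
  have hk : 1 ≤ k := by
    have : (1 : ℝ) ≤ k := by linarith
    exact_mod_cast this
  have hx : 0 < (k : ℝ) / 2 - s := by linarith
  have h := rpow_mul_Gamma_le_Gamma_add hx hs1
  rw [sub_add_cancel] at h
  have hG : 0 < Real.Gamma ((k : ℝ) / 2) := Real.Gamma_pos_of_pos (by linarith)
  rw [(integral_rpow_chiSquared hk hs).2, div_le_iff₀ hG]
  have e : (k : ℝ) - 2 * s = 2 * ((k : ℝ) / 2 - s) := by ring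
  rw [e, Real.mul_rpow (by norm_num) hx.le, mul_assoc]
  refine mul_le_mul_of_nonneg_left ?_ (by positivity)
  rw [Real.rpow_neg hx.le, ← div_eq_inv_mul, le_div_iff₀ (by positivity), mul_comm]
  exact h

lemma integrable_inv_chiSquared {k : ℕ} (hk : 3 ≤ k) :
    Integrable (fun v => v⁻¹) (chiSquared k) := by
  have hk' : (3 : ℝ) ≤ k := by exact_mod_cast hk
  have h := (integral_rpow_chiSquared (k := k) (by omega) (s := 1) (by linarith)).1
  simpa only [Real.rpow_neg_one] using h

lemma integral_inv_chiSquared {k : ℕ} (hk : 3 ≤ k) :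
    ∫ v, v⁻¹ ∂(chiSquared k) = 1 / ((k : ℝ) - 2) := by
  have hk' : (3 : ℝ) ≤ k := by exact_mod_cast hk
  have h := (integral_rpow_chiSquared (k := k) (by omega) (s := 1) (by linarith)).2
  simp only [Real.rpow_neg_one] at h
  have hG : 0 < Real.Gamma ((k : ℝ) / 2 - 1) := Real.Gamma_pos_of_pos (by linarith)
  have e : Real.Gamma ((k : ℝ) / 2) = ((k : ℝ) / 2 - 1) * Real.Gamma ((k : ℝ) / 2 - 1) := by
    rw [← Real.Gamma_add_one (by linarith), sub_add_cancel]
  rw [h, e, mul_div_mul_right _ _ hG.ne']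
  have : (k : ℝ) - 2 ≠ 0 := by linarith
  have : (k : ℝ) / 2 - 1 ≠ 0 := by linarith
  field_simp

lemma integrable_id_chiSquared {k : ℕ} (hk : 1 ≤ k) : Integrable (fun u => u) (chiSquared k) := by
  have h := (integral_rpow_chiSquared hk (s := -1)
    (neg_one_lt_zero.trans_le (by positivity))).1
  simpa only [neg_neg, Real.rpow_one] using h

lemma integral_id_chiSquared {k : ℕ} (hk : 1 ≤ k) : ∫ u, u ∂(chiSquared k) = k := by
  have h := (integral_rpow_chiSquared hk (s := -1)
    (neg_one_lt_zero.trans_le (by positivity))).2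
  have hk' : (0 : ℝ) < k := by exact_mod_cast hk
  have hG : 0 < Real.Gamma ((k : ℝ) / 2) := Real.Gamma_pos_of_pos (by positivity)
  simp only [neg_neg, Real.rpow_one, sub_neg_eq_add] at h
  rw [h, Real.Gamma_add_one (by positivity)]
  field_simp

lemma integrable_div_chiSquared_prod {a b : ℕ} (ha : 1 ≤ a) (hb : 3 ≤ b) :
    Integrable (fun p : ℝ × ℝ => p.1 / p.2) ((chiSquared a).prod (chiSquared b)) := by
  simp only [div_eq_mul_inv]
  exact (integrable_id_chiSquared ha).mul_prod (integrable_inv_chiSquared hb)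

lemma integral_div_chiSquared_prod {a b : ℕ} (ha : 1 ≤ a) (hb : 3 ≤ b) :
    ∫ p : ℝ × ℝ, p.1 / p.2 ∂((chiSquared a).prod (chiSquared b)) = a / ((b : ℝ) - 2) := by
  simp only [div_eq_mul_inv]
  rw [integral_prod_mul (fun u => u) (fun v => v⁻¹), integral_id_chiSquared ha,
    integral_inv_chiSquared hb, one_div]

end ChiSquared

/-! ### Fisher laws and the functions `Fish` and `EFish` -/

section Fisher

variable {D N : ℕ}

instance : IsProbabilityMeasure (fisherLaw D N) :=
  Measure.isProbabilityMeasure_map (by fun_prop)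

lemma ae_nonneg_fisherLaw : ∀ᵐ t ∂(fisherLaw D N), 0 ≤ t := by
  rw [fisherLaw, ae_map_iff (by fun_prop) measurableSet_Ici]
  have h1 := Measure.quasiMeasurePreserving_fst (μ := chiSquared D) (ν := chiSquared N) |>.ae
    (ae_nonneg_chiSquared D)
  have h2 := Measure.quasiMeasurePreserving_snd (μ := chiSquared D) (ν := chiSquared N) |>.ae
    (ae_nonneg_chiSquared N)
  filter_upwards [h1, h2] with p hp1 hp2
  positivity

lemma integrable_id_fisherLaw (hD : 1 ≤ D) (hN : 3 ≤ N) :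
    Integrable (fun t => t) (fisherLaw D N) := by
  rw [fisherLaw, integrable_map_measure (by fun_prop) (by fun_prop)]
  refine ((integrable_div_chiSquared_prod hD hN).const_mul ((N : ℝ) / D)).congr
    (.of_forall fun p => ?_)
  simp only [Function.comp]
  rw [div_div_div_eq, div_mul_div_comm]
  ring

lemma integral_id_fisherLaw (hD : 1 ≤ D) (hN : 3 ≤ N) :
    ∫ t, t ∂(fisherLaw D N) = N / ((N : ℝ) - 2) := by
  have hD' : (0 : ℝ) < D := by exact_mod_cast hD
  rw [fisherLaw, integral_map (by fun_prop) (by fun_prop)]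
  have e : ∀ p : ℝ × ℝ, p.1 / D / (p.2 / N) = (N : ℝ) / D * (p.1 / p.2) := by
    intro p
    rw [div_div_div_eq, div_mul_div_comm]
    ring
  simp_rw [e]
  rw [integral_const_mul, integral_div_chiSquared_prod hD hN]
  field_simp

lemma integral_id_fisherLaw_pos (hD : 1 ≤ D) (hN : 3 ≤ N) : 0 < ∫ t, t ∂(fisherLaw D N) := by
  have hN' : (3 : ℝ) ≤ N := by exact_mod_cast hN
  rw [integral_id_fisherLaw hD hN]
  exact div_pos (by linarith) (by linarith)

lemma integrable_posPart_sub_fisherLaw (hD : 1 ≤ D) (hN : 3 ≤ N) (x : ℝ) :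
    Integrable (fun t => max (t - x) 0) (fisherLaw D N) :=
  ((integrable_id_fisherLaw hD hN).sub (integrable_const x)).pos_part

lemma Fish_nonneg (x : ℝ) : 0 ≤ Fish D N x :=
  div_nonneg (integral_nonneg fun _ => le_max_right _ _)
    (integral_nonneg_of_ae ae_nonneg_fisherLaw)

lemma Fish_antitone (hD : 1 ≤ D) (hN : 3 ≤ N) : Antitone (Fish D N) := by
  intro x y hxy
  refine div_le_div_of_nonneg_right ?_ (integral_id_fisherLaw_pos hD hN).le
  exact integral_mono (integrable_posPart_sub_fisherLaw hD hN y)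
    (integrable_posPart_sub_fisherLaw hD hN x)
    fun t => max_le_max (by linarith) le_rfl

lemma Fish_zero (hD : 1 ≤ D) (hN : 3 ≤ N) : Fish D N 0 = 1 := by
  rw [Fish, div_eq_one_iff_eq (integral_id_fisherLaw_pos hD hN).ne']
  refine integral_congr_ae ?_
  filter_upwards [ae_nonneg_fisherLaw] with t ht
  simp [ht]

lemma continuousOn_Fish (hD : 1 ≤ D) (hN : 3 ≤ N) : ContinuousOn (Fish D N) (Set.Ici 0) := by
  refine ContinuousOn.div_const ?_ _
  refine continuousOn_of_dominated (bound := fun t => t) (fun x _ => by fun_prop) (fun x hx => ?_)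
    (integrable_id_fisherLaw hD hN) (.of_forall fun t => by fun_prop)
  filter_upwards [ae_nonneg_fisherLaw] with t ht
  have hx : 0 ≤ x := hx
  rw [Real.norm_eq_abs, abs_of_nonneg (le_max_right _ _)]
  exact max_le (by linarith) ht

lemma tendsto_Fish_atTop (hD : 1 ≤ D) (hN : 3 ≤ N) :
    Filter.Tendsto (Fish D N) Filter.atTop (nhds 0) := by
  have h : Filter.Tendsto (fun x => ∫ t, max (t - x) 0 ∂(fisherLaw D N)) Filter.atTop
      (nhds (∫ _, (0 : ℝ) ∂(fisherLaw D N))) := by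
    refine tendsto_integral_filter_of_dominated_convergence (fun t => t)
      (.of_forall fun x => by fun_prop) ?_ (integrable_id_fisherLaw hD hN)
      (.of_forall fun t => ?_)
    · filter_upwards [Filter.eventually_ge_atTop 0] with x hx
      filter_upwards [ae_nonneg_fisherLaw] with t ht
      rw [Real.norm_eq_abs, abs_of_nonneg (le_max_right _ _)]
      exact max_le (by linarith) ht
    · refine tendsto_const_nhds.congr' ?_
      filter_upwards [Filter.eventually_ge_atTop t] with x hx
      rw [max_eq_right (by linarith)]
  have h2 := h.div_const (∫ t, t ∂(fisherLaw D N))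
  rw [integral_zero, zero_div] at h2
  exact h2

/-- `EFish` solves its defining equation. -/
lemma Fish_EFish (hD : 1 ≤ D) (hN : 3 ≤ N) {q : ℝ} (hq : 0 < q) (hq1 : q ≤ 1) :
    Fish D N (EFish D N q) = q := by
  -- Intermediate values: `Fish` is continuous on the half-line, equals 1 at 0 and tends to 0 at
  -- infinity.
  have hex : ∃ x : ℝ, 0 ≤ x ∧ Fish D N x = q := by
    obtain ⟨b, hb, hb0⟩ := ((tendsto_Fish_atTop hD hN).eventually_lt_const hq |>.and
      (Filter.eventually_ge_atTop 0)).exists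
    obtain ⟨x, hx, hxq⟩ := intermediate_value_Icc' hb0
      ((continuousOn_Fish hD hN).mono Set.Icc_subset_Ici_self)
      (show q ∈ Set.Icc (Fish D N b) (Fish D N 0) from
        ⟨hb.le, by rw [Fish_zero hD hN]; exact hq1⟩)
    exact ⟨x, hx.1, hxq⟩
  have h : q ≤ 1 ∧ ∃ x : ℝ, 0 ≤ x ∧ Fish D N x = q := ⟨hq1, hex⟩
  rw [EFish, dif_pos h]
  exact h.2.choose_spec.2

end Fisher

/-! ### Loss and criterion of a single model in terms of the noise -/

section Model

variable {n : ℕ} (S : Submodule ℝ (EuclideanSpace ℝ (Fin n))) (μ : EuclideanSpace ℝ (Fin n))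
  (σ : ℝ)

/-- The bias of the model `S` in units of the noise level. -/
noncomputable def bias : EuclideanSpace ℝ (Fin n) := σ⁻¹ • (μ - S.starProjection μ)

/-- The ratio of the variance to its estimator, as a function of the noise. -/
noncomputable def varRatio (x : EuclideanSpace ℝ (Fin n)) : ℝ :=
  codimN S / ‖bias S μ σ + (x - S.starProjection x)‖ ^ 2

variable {S μ σ}

lemma dimD_add_codimN (S : Submodule ℝ (EuclideanSpace ℝ (Fin n))) :
    (dimD S : ℝ) + codimN S = n := by
  have h : dimD S ≤ n := by
    simpa [dimD] using Submodule.finrank_le S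
  rw [codimN, Nat.cast_sub h]
  ring

/-- On Tᗮ the observation is pure noise. An arbitrary direction is added when μ already lies in S,
so that the degrees of freedom are D + 1 and N - 1 in all cases. -/
lemma exists_augmented_model (μ : EuclideanSpace ℝ (Fin n)) (hS : dimD S < n) :
    ∃ T : Submodule ℝ (EuclideanSpace ℝ (Fin n)),
      S ≤ T ∧ μ ∈ T ∧ Module.finrank ℝ T = dimD S + 1 := by
  by_cases hμ : μ ∈ S
  · have hne : S ≠ ⊤ := by
      rintro rfl
      simp [dimD] at hS
    obtain ⟨w, hw⟩ := SetLike.exists_not_mem_of_ne_top S hne rfl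
    exact ⟨S ⊔ Submodule.span ℝ {w}, le_sup_left, le_sup_left (a := S) hμ,
      Submodule.finrank_sup_span_singleton hw⟩
  · exact ⟨S ⊔ Submodule.span ℝ {μ}, le_sup_left,
      (le_sup_right : _ ≤ S ⊔ _) (Submodule.mem_span_singleton_self μ),
      Submodule.finrank_sup_span_singleton hμ⟩

lemma finrank_orthogonal_augmented {T : Submodule ℝ (EuclideanSpace ℝ (Fin n))}
    (hT : Module.finrank ℝ T = dimD S + 1) : Module.finrank ℝ Tᗮ = codimN S - 1 := by
  have h := Submodule.finrank_add_finrank_orthogonal T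
  rw [hT, finrank_euclideanSpace_fin] at h
  unfold codimN
  omega

lemma norm_sq_eq_projection_add (T : Submodule ℝ (EuclideanSpace ℝ (Fin n)))
    (x : EuclideanSpace ℝ (Fin n)) :
    ‖x‖ ^ 2 = ‖T.starProjection x‖ ^ 2 + ‖Tᗮ.starProjection x‖ ^ 2 := by
  rw [Submodule.norm_sq_eq_add_norm_sq_projection x T]
  rfl

lemma inner_bias_starProjection (x : EuclideanSpace ℝ (Fin n)) :
    inner ℝ (bias S μ σ) (S.starProjection x) = 0 := by
  rw [bias, real_inner_smul_left, real_inner_comm,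
    S.sub_starProjection_mem_orthogonal μ _ (S.starProjection_apply_mem x), mul_zero]

lemma bias_mem {T : Submodule ℝ (EuclideanSpace ℝ (Fin n))} (hST : S ≤ T) (hμ : μ ∈ T) :
    bias S μ σ ∈ T :=
  T.smul_mem _ (T.sub_mem hμ (hST (S.starProjection_apply_mem μ)))

lemma norm_sq_sub_starProjection (x : EuclideanSpace ℝ (Fin n)) :
    ‖x - S.starProjection x‖ ^ 2 = ‖x‖ ^ 2 - ‖S.starProjection x‖ ^ 2 := by
  rw [norm_sq_eq_projection_add S x, S.starProjection_orthogonal_val]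
  ring

lemma norm_sq_bias_add_residual (x : EuclideanSpace ℝ (Fin n)) :
    ‖bias S μ σ + (x - S.starProjection x)‖ ^ 2 =
      ‖bias S μ σ‖ ^ 2 + 2 * inner ℝ (bias S μ σ) x + ‖x‖ ^ 2 - ‖S.starProjection x‖ ^ 2 := by
  rw [norm_add_sq_real, inner_sub_right, inner_bias_starProjection, norm_sq_sub_starProjection]
  ring

lemma norm_sq_bias_add_residual_le (x : EuclideanSpace ℝ (Fin n)) :
    ‖bias S μ σ + (x - S.starProjection x)‖ ^ 2 ≤ 2 * ‖bias S μ σ‖ ^ 2 + 2 * ‖x‖ ^ 2 := by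
  have h := norm_sq_bias_add_residual (S := S) (μ := μ) (σ := σ) x
  have h2 := norm_sub_sq_real (bias S μ σ) x
  nlinarith [sq_nonneg ‖bias S μ σ - x‖, sq_nonneg ‖S.starProjection x‖]

lemma residual_eq (hσ : 0 < σ) (x : EuclideanSpace ℝ (Fin n)) :
    (μ + σ • x) - S.starProjection (μ + σ • x) =
      σ • (bias S μ σ + (x - S.starProjection x)) := by
  rw [bias, smul_add, smul_inv_smul₀ hσ.ne', map_add, map_smul, smul_sub]
  abel

lemma sigmaHatSq_eq (hσ : 0 < σ) (x : EuclideanSpace ℝ (Fin n)) :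
    sigmaHatSq S (μ + σ • x) = σ ^ 2 / varRatio S μ σ x := by
  rw [sigmaHatSq, residual_eq hσ, varRatio, norm_smul, mul_pow, Real.norm_eq_abs, sq_abs]
  rw [div_div_eq_mul_div]

lemma norm_sq_mean_sub_estimator (hσ : 0 < σ) (x : EuclideanSpace ℝ (Fin n)) :
    ‖μ - S.starProjection (μ + σ • x)‖ ^ 2 =
      σ ^ 2 * (‖bias S μ σ‖ ^ 2 + ‖S.starProjection x‖ ^ 2) := by
  have e : μ - S.starProjection (μ + σ • x) = σ • (bias S μ σ - S.starProjection x) := by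
    rw [bias, smul_sub, smul_inv_smul₀ hσ.ne', map_add, map_smul]
    abel
  rw [e, norm_smul, mul_pow, Real.norm_eq_abs, sq_abs, norm_sub_sq_real,
    inner_bias_starProjection]
  ring

lemma kullback_eq (hσ : 0 < σ) (hn : 0 < n) {x : EuclideanSpace ℝ (Fin n)} :
    kullback (μ, σ ^ 2) (thetaHat S (μ + σ • x)) =
      (n : ℝ) / 2 * (-Real.log (varRatio S μ σ x) + varRatio S μ σ x - 1) +
        1 / 2 * (varRatio S μ σ x * (‖bias S μ σ‖ ^ 2 + ‖S.starProjection x‖ ^ 2)) := by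
  have hn' : (n : ℝ) ≠ 0 := by positivity
  simp only [kullback, thetaHat]
  rw [norm_sq_mean_sub_estimator hσ, sigmaHatSq_eq hσ]
  -- No positivity of y is needed: at y = 0 both sides agree through the conventions a/0 = 0 and log
  -- 0 = 0.
  generalize varRatio S μ σ x = y
  have hσ' : σ ^ 2 ≠ 0 := by positivity
  have e1 : σ ^ 2 / y / σ ^ 2 = y⁻¹ := by field_simp
  have e2 : σ ^ 2 / (σ ^ 2 / y) = y := by field_simp
  rw [e1, e2, Real.log_inv, mul_div_assoc', div_div_eq_mul_div]
  field_simp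

lemma critK_eq (hσ : 0 < σ) (p : ℝ) {x : EuclideanSpace ℝ (Fin n)}
    (hy : 0 < varRatio S μ σ x) :
    critK S p (μ + σ • x) =
      (n : ℝ) / 2 * (Real.log (σ ^ 2) - Real.log (varRatio S μ σ x)) + 1 / 2 * p := by
  have h := sigmaHatSq_eq (S := S) (μ := μ) hσ x
  unfold sigmaHatSq at h
  rw [critK, h, Real.log_div (by positivity) hy.ne']

/-- The bias and Πx lie in T, so the projection onto Tᗮ of the residual is that of x alone. This
bounds σ̂² below by a variable whose law does not depend on μ. -/
lemma norm_sq_orthogonal_augmented_le {T : Submodule ℝ (EuclideanSpace ℝ (Fin n))} (hST : S ≤ T)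
    (hμ : μ ∈ T) (x : EuclideanSpace ℝ (Fin n)) :
    ‖Tᗮ.starProjection x‖ ^ 2 ≤ ‖bias S μ σ + (x - S.starProjection x)‖ ^ 2 := by
  have e : Tᗮ.starProjection (bias S μ σ + (x - S.starProjection x)) = Tᗮ.starProjection x := by
    have h1 : T.starProjection (bias S μ σ) = bias S μ σ :=
      Submodule.starProjection_eq_self_iff.2 (bias_mem hST hμ)
    have h2 : T.starProjection (S.starProjection x) = S.starProjection x :=
      Submodule.starProjection_eq_self_iff.2 (hST (S.starProjection_apply_mem x))
    simp only [Submodule.starProjection_orthogonal_val, map_add, map_sub, h1, h2]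
    abel
  rw [← e]
  gcongr
  exact Submodule.norm_starProjection_apply_le _ _

lemma varRatio_nonneg (x : EuclideanSpace ℝ (Fin n)) : 0 ≤ varRatio S μ σ x := by
  unfold varRatio
  positivity

lemma varRatio_pos (hS : dimD S < n) {T : Submodule ℝ (EuclideanSpace ℝ (Fin n))} (hST : S ≤ T)
    (hμ : μ ∈ T) {x : EuclideanSpace ℝ (Fin n)} (hV : 0 < ‖Tᗮ.starProjection x‖ ^ 2) :
    0 < varRatio S μ σ x := by
  have hN : 0 < codimN S := by unfold codimN; omega
  have h := norm_sq_orthogonal_augmented_le (σ := σ) hST hμ x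
  unfold varRatio
  have : (0 : ℝ) < codimN S := by exact_mod_cast hN
  exact div_pos this (by linarith)

lemma varRatio_le {T : Submodule ℝ (EuclideanSpace ℝ (Fin n))} (hST : S ≤ T)
    (hμ : μ ∈ T) {x : EuclideanSpace ℝ (Fin n)} (hV : 0 < ‖Tᗮ.starProjection x‖ ^ 2) :
    varRatio S μ σ x ≤ codimN S / ‖Tᗮ.starProjection x‖ ^ 2 :=
  div_le_div_of_nonneg_left (by positivity) hV (norm_sq_orthogonal_augmented_le hST hμ x)

/-- This identity eliminates the bias from the loss in `loss_comparison`. Positivity excludes a zero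
residual, where the quotient has its default value. -/
lemma varRatio_mul {x : EuclideanSpace ℝ (Fin n)} (hy : 0 < varRatio S μ σ x) :
    varRatio S μ σ x * (‖bias S μ σ‖ ^ 2 + 2 * inner ℝ (bias S μ σ) x + ‖x‖ ^ 2 -
      ‖S.starProjection x‖ ^ 2) = codimN S := by
  rw [← norm_sq_bias_add_residual]
  unfold varRatio at hy ⊢
  refine div_mul_cancel₀ _ fun h => ?_
  rw [h, div_zero] at hy
  exact lt_irrefl _ hy

/-- The bias v lies in T and is orthogonal to S, so it only sees w = Tx - Sx, and ‖w‖² = ‖Tx‖² -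
‖Sx‖². Young's inequality for ⟨v, w⟩ and 2 ≤ 1/K + K for the coefficient of ‖Sx‖² add up to the
bound, the terms K‖Sx‖² cancelling. -/
lemma two_mul_cross_term_le {T : Submodule ℝ (EuclideanSpace ℝ (Fin n))} (hST : S ≤ T)
    (hμ : μ ∈ T) {K : ℝ} (hK : 0 < K) (x : EuclideanSpace ℝ (Fin n)) :
    2 * ‖S.starProjection x‖ ^ 2 - 2 * inner ℝ (bias S μ σ) x ≤
      1 / K * (‖bias S μ σ‖ ^ 2 + ‖S.starProjection x‖ ^ 2) + K * ‖T.starProjection x‖ ^ 2 := by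
  have h1 : S.starProjection (T.starProjection x) = S.starProjection x := by
    rw [← ContinuousLinearMap.comp_apply,
      Submodule.starProjection_comp_starProjection_of_le hST]
  have h2 : inner ℝ (bias S μ σ) x =
      inner ℝ (bias S μ σ) (T.starProjection x - S.starProjection x) := by
    rw [inner_sub_right, inner_bias_starProjection, sub_zero,
      ← Submodule.inner_starProjection_left_eq_right,
      Submodule.starProjection_eq_self_iff.2 (bias_mem hST hμ)]
  have h3 := norm_sq_sub_starProjection (S := S) (T.starProjection x)
  rw [h1] at h3
  set v := bias S μ σ
  set w := T.starProjection x - S.starProjection x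
  have hK' : 0 ≤ 1 / K := by positivity
  have hKK : 1 / K * K = 1 := by field_simp
  have h4 : 0 ≤ 1 / K * ‖v + K • w‖ ^ 2 := by positivity
  rw [norm_add_sq_real, norm_smul, real_inner_smul_right, mul_pow, Real.norm_eq_abs, sq_abs] at h4
  have h5 : 1 / K * (‖v‖ ^ 2 + 2 * (K * inner ℝ v w) + K ^ 2 * ‖w‖ ^ 2) =
      1 / K * ‖v‖ ^ 2 + 2 * inner ℝ v w + K * ‖w‖ ^ 2 := by
    field_simp
  have h6 : 2 ≤ 1 / K + K := by
    have : 1 / K + K - 2 = 1 / K * (K - 1) ^ 2 := by field_simp; ring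
    nlinarith [mul_nonneg hK' (sq_nonneg (K - 1))]
  rw [h5] at h4
  rw [h2]
  nlinarith [mul_le_mul_of_nonneg_right h6 (sq_nonneg ‖S.starProjection x‖)]

end Model

/-- The case split is on the sign of the coefficient. If it is nonpositive, only y' contributes,
with weight at most n. If it is positive, it is at most X, and y - y' ≤ y log(y/y') ≤ y p/n. -/
lemma noise_term_le {n X a y y' p : ℝ} (hn : 0 < n) (hX : 0 ≤ X) (ha : 0 ≤ a) (ha1 : a ≤ 1)
    (hy : 0 < y) (hy' : 0 < y') (hp : 0 ≤ p) (hlog : n * (Real.log y - Real.log y') ≤ p) :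
    (n * a - (n - X)) * (y - y') ≤
      p * (X * y / n) + n * (if X ≤ n * (1 - a) then y' else 0) := by
  have hna : 0 ≤ n * a := by positivity
  have hna1 : n * a ≤ n := mul_le_of_le_one_right hn.le ha1
  split_ifs with h
  · have h1 : 0 ≤ (n - X) - n * a := by linarith
    have h2 : (n - X) - n * a ≤ n := by linarith
    have h3 : 0 ≤ p * (X * y / n) := by positivity
    linarith [mul_le_mul_of_nonneg_right h2 hy'.le, mul_nonneg h1 hy.le]
  · have h1 : 0 ≤ n * a - (n - X) := by linarith
    have h2 : n * a - (n - X) ≤ X := by linarith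
    have h3 : y - y' ≤ y * (p / n) := by
      have h4 : Real.log (y' / y) ≤ y' / y - 1 := Real.log_le_sub_one_of_pos (by positivity)
      rw [Real.log_div hy'.ne' hy.ne'] at h4
      have h5 : Real.log y - Real.log y' ≤ p / n := by
        rw [le_div_iff₀ hn]
        linarith
      have h6 : y * (y' / y) = y' := by field_simp
      linarith [mul_le_mul_of_nonneg_left h4 hy.le, mul_le_mul_of_nonneg_left h5 hy.le]
    have h7 : 0 ≤ y * (p / n) := by positivity
    have h8 : p * (X * y / n) = X * (y * (p / n)) := by ring
    rw [h8]
    linarith [mul_le_mul_of_nonneg_left h3 h1, mul_le_mul_of_nonneg_right h2 h7]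

/-- The comparison of the losses of two models, as an inequality between real numbers. The
quantities without a prime refer to the reference model, those with a prime to a model with a
smaller criterion. -/
lemma loss_comparison {n X K₁ K₂ : ℝ} (hn : 0 < n) (hX : 0 ≤ X) (hK₁ : 1 < K₁) (hK₂ : K₁ ≤ K₂)
    {y v c s N D p : ℝ} (hy : 0 < y) (hyN : y * (v + 2 * c + X - s) = N) (hDN : D + N = n)
    (hs : 0 ≤ s) (hp : 0 ≤ p)
    {y' v' c' s' N' D' p' U' : ℝ} (hy' : 0 < y') (hyN' : y' * (v' + 2 * c' + X - s') = N')
    (hDN' : D' + N' = n) (hp' : 0 ≤ p')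
    (hcross : 2 * s' - 2 * c' ≤ 1 / K₁ * (v' + s') + K₁ * U')
    (hcrit : n / 2 * (-Real.log y') + 1 / 2 * p' ≤ n / 2 * (-Real.log y) + 1 / 2 * p) :
    (1 - 1 / K₁) * (n / 2 * (-Real.log y' + y' - 1) + 1 / 2 * (y' * (v' + s'))) ≤
      (n / 2 * (-Real.log y + y - 1) + 1 / 2 * (y * (v + s))) + 1 / 2 * (D + (1 - 1 / K₂) * p) +
        1 / 2 * (K₁ * U' * y' - D' - (1 - 1 / K₂) * p') + y * c + 1 / 2 * (p * (X * y / n)) +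
        n / 2 * (if X ≤ n * (1 - 1 / K₂) then y' else 0) := by
  have hK₁0 : 0 < K₁ := by linarith
  have hK₂0 : 0 < K₂ := by linarith
  have hK₂1 : 1 / K₂ ≤ 1 := by rw [div_le_one hK₂0]; linarith
  have hK₂p : 0 < 1 / K₂ := by positivity
  have hK₁₂ : 1 / K₂ ≤ 1 / K₁ := one_div_le_one_div_of_le hK₁0 hK₂
  set a := 1 / K₂ with ha
  set b := 1 / K₁ with hb
  have hlog : Real.log y ≤ y - 1 := Real.log_le_sub_one_of_pos hy
  have hlog' : Real.log y' ≤ y' - 1 := Real.log_le_sub_one_of_pos hy'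
  have hys : 0 ≤ y * s := by positivity
  have hcr := mul_le_mul_of_nonneg_left hcross hy'.le
  -- The left side gives up a share 1/K₁ of n/2 (y' - 1 - log y'), of which only 1/K₂ ≤ 1/K₁ is
  -- used. The criterion is weighted by 1 - 1/K₂ accordingly, and log y ≤ y - 1 treats the share
  -- 1/K₂ for the reference model.
  have hbφ := mul_le_mul_of_nonneg_right hK₁₂
    (mul_nonneg (by positivity : 0 ≤ n / 2) (by linarith : 0 ≤ y' - 1 - Real.log y'))
  have hcr2 := mul_le_mul_of_nonneg_left hcrit (by linarith : 0 ≤ 1 - a)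
  have hlog2 := mul_le_mul_of_nonneg_left hlog (by positivity : 0 ≤ n / 2 * a)
  have hnoise := noise_term_le hn hX hK₂p.le hK₂1 hy hy' hp (by linarith)
  have hN : D = n - N := by linarith
  have hN' : D' = n - N' := by linarith
  -- After this substitution the claim is a linear combination of the inequalities above, with
  -- products such as y * X as atoms.
  rw [hN, hN', ← hyN, ← hyN']
  have hi : n / 2 * (if X ≤ n * (1 - a) then y' else 0) =
      1 / 2 * (n * (if X ≤ n * (1 - a) then y' else 0)) := by ring
  rw [hi]
  generalize (n * (if X ≤ n * (1 - a) then y' else 0)) = Q at *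
  linarith [hcr, hbφ, hcr2, hlog2, hnoise, hys]

/-! ### Integrability and expectations for a single model -/

section Expectation

variable {n : ℕ} {S T : Submodule ℝ (EuclideanSpace ℝ (Fin n))} {μ : EuclideanSpace ℝ (Fin n)}
  {σ : ℝ}

lemma measurePreserving_augmented (hT : Module.finrank ℝ T = dimD S + 1) :
    MeasurePreserving (fun x => (‖T.starProjection x‖ ^ 2, ‖Tᗮ.starProjection x‖ ^ 2))
      (stdGaussian (EuclideanSpace ℝ (Fin n)))
      ((chiSquared (dimD S + 1)).prod (chiSquared (codimN S - 1))) := by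
  refine ⟨by fun_prop, ?_⟩
  rw [stdGaussian_map_sq_norm_starProjection, hT, finrank_orthogonal_augmented hT]

lemma five_le_codimN (hS : dimD S + 5 ≤ n) : (5 : ℝ) ≤ codimN S := by
  have : 5 ≤ codimN S := by unfold codimN; omega
  exact_mod_cast this

lemma three_le_codimN_sub_one (hS : dimD S + 5 ≤ n) : 3 ≤ codimN S - 1 := by
  unfold codimN; omega

lemma cast_codimN_sub_one (hS : dimD S + 5 ≤ n) :
    ((codimN S - 1 : ℕ) : ℝ) = (codimN S : ℝ) - 1 := by
  have : 1 ≤ codimN S := by unfold codimN; omega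
  push_cast [Nat.cast_sub this]
  ring

lemma ae_pos_orthogonal_augmented (hS : dimD S + 5 ≤ n) (hT : Module.finrank ℝ T = dimD S + 1) :
    ∀ᵐ x ∂(stdGaussian (EuclideanSpace ℝ (Fin n))), 0 < ‖Tᗮ.starProjection x‖ ^ 2 :=
  ((Measure.quasiMeasurePreserving_snd (μ := chiSquared (dimD S + 1))).comp
    (measurePreserving_augmented hT).quasiMeasurePreserving).ae
    (ae_pos_chiSquared (by have := three_le_codimN_sub_one hS; omega))

lemma integrable_augmented_ratio (hS : dimD S + 5 ≤ n)
    (hT : Module.finrank ℝ T = dimD S + 1) :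
    Integrable (fun x => ‖T.starProjection x‖ ^ 2 / ‖Tᗮ.starProjection x‖ ^ 2)
      (stdGaussian (EuclideanSpace ℝ (Fin n))) :=
  (measurePreserving_augmented hT).integrable_comp_of_integrable
    (integrable_div_chiSquared_prod (by omega) (three_le_codimN_sub_one hS))

lemma integral_augmented_ratio (hS : dimD S + 5 ≤ n)
    (hT : Module.finrank ℝ T = dimD S + 1) :
    ∫ x, ‖T.starProjection x‖ ^ 2 / ‖Tᗮ.starProjection x‖ ^ 2
      ∂(stdGaussian (EuclideanSpace ℝ (Fin n))) = ((dimD S : ℝ) + 1) / ((codimN S : ℝ) - 3) := by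
  have h := integral_div_chiSquared_prod (a := dimD S + 1) (by omega) (three_le_codimN_sub_one hS)
  rw [← (measurePreserving_augmented hT).map_eq, integral_map
    (measurePreserving_augmented hT).aemeasurable (by fun_prop), cast_codimN_sub_one hS] at h
  rw [h]
  push_cast
  congr 1
  ring

lemma measurePreserving_orthogonal_augmented (hT : Module.finrank ℝ T = dimD S + 1) :
    MeasurePreserving (fun x => ‖Tᗮ.starProjection x‖ ^ 2)
      (stdGaussian (EuclideanSpace ℝ (Fin n))) (chiSquared (codimN S - 1)) :=
  measurePreserving_snd.comp (measurePreserving_augmented hT)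

lemma integrable_inv_augmented (hS : dimD S + 5 ≤ n) (hT : Module.finrank ℝ T = dimD S + 1) :
    Integrable (fun x => (‖Tᗮ.starProjection x‖ ^ 2)⁻¹)
      (stdGaussian (EuclideanSpace ℝ (Fin n))) :=
  (measurePreserving_orthogonal_augmented hT).integrable_comp_of_integrable
    (integrable_inv_chiSquared (three_le_codimN_sub_one hS))

lemma rpow_div_eq_mul_rpow_neg {N V p : ℝ} (hN : 0 ≤ N) (hV : 0 ≤ V) :
    (N / V) ^ p = N ^ p * V ^ (-p) := by
  rw [Real.div_rpow hN hV, Real.rpow_neg hV, div_eq_mul_inv]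

lemma integrable_rpow_augmented (hS : dimD S + 5 ≤ n) (hT : Module.finrank ℝ T = dimD S + 1)
    {p : ℝ} (hp : p ≤ (codimN S : ℝ) / 4) :
    Integrable (fun x => ((codimN S : ℝ) / ‖Tᗮ.starProjection x‖ ^ 2) ^ p)
      (stdGaussian (EuclideanSpace ℝ (Fin n))) := by
  have hN := five_le_codimN hS
  have h := (integral_rpow_chiSquared (k := codimN S - 1) (s := p)
    (by have := three_le_codimN_sub_one hS; omega)
    (by rw [cast_codimN_sub_one hS]; linarith)).1
  refine (((measurePreserving_orthogonal_augmented hT).integrable_comp_of_integrable h).const_mul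
    ((codimN S : ℝ) ^ p)).congr (.of_forall fun x => ?_)
  simp only [Function.comp]
  rw [rpow_div_eq_mul_rpow_neg (by positivity) (by positivity)]

/-- The inverse moment bound gives (N/(N - 1 - 2p))^p, and p ≤ N/4 with N ≥ 5 makes the base at most
5, uniformly over the models. -/
lemma integral_rpow_augmented_le (hS : dimD S + 5 ≤ n) (hT : Module.finrank ℝ T = dimD S + 1)
    {p : ℝ} (hp1 : 1 ≤ p) (hp : p ≤ (codimN S : ℝ) / 4) :
    ∫ x, ((codimN S : ℝ) / ‖Tᗮ.starProjection x‖ ^ 2) ^ p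
      ∂(stdGaussian (EuclideanSpace ℝ (Fin n))) ≤ 5 ^ p := by
  have hN := five_le_codimN hS
  have h := integral_rpow_neg_chiSquared_le (k := codimN S - 1) (s := p) hp1
    (by rw [cast_codimN_sub_one hS]; linarith)
  rw [← (measurePreserving_orthogonal_augmented hT).map_eq, integral_map
    (measurePreserving_orthogonal_augmented hT).aemeasurable (by fun_prop),
    cast_codimN_sub_one hS] at h
  have e : ∀ x : EuclideanSpace ℝ (Fin n),
      ((codimN S : ℝ) / ‖Tᗮ.starProjection x‖ ^ 2) ^ p =
        (codimN S : ℝ) ^ p * (‖Tᗮ.starProjection x‖ ^ 2) ^ (-p) := fun x =>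
    rpow_div_eq_mul_rpow_neg (by positivity) (by positivity)
  simp_rw [e]
  rw [integral_const_mul]
  refine (mul_le_mul_of_nonneg_left h (by positivity)).trans ?_
  rw [← rpow_div_eq_mul_rpow_neg (by positivity) (by linarith)]
  refine Real.rpow_le_rpow (div_nonneg (by positivity) (by linarith)) ?_ (by linarith)
  rw [div_le_iff₀ (by linarith)]
  linarith

@[fun_prop]
lemma measurable_varRatio : Measurable (varRatio S μ σ) := by
  unfold varRatio
  fun_prop

lemma integrable_varRatio (hS : dimD S + 5 ≤ n) (hST : S ≤ T) (hμ : μ ∈ T)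
    (hT : Module.finrank ℝ T = dimD S + 1) :
    Integrable (varRatio S μ σ) (stdGaussian (EuclideanSpace ℝ (Fin n))) := by
  refine ((integrable_inv_augmented hS hT).const_mul (codimN S : ℝ)).mono'
    measurable_varRatio.aestronglyMeasurable ?_
  filter_upwards [ae_pos_orthogonal_augmented hS hT] with x hx
  rw [Real.norm_eq_abs, abs_of_nonneg (varRatio_nonneg x), ← div_eq_mul_inv]
  exact varRatio_le hST hμ hx

lemma sq_norm_mul_varRatio_le (hST : S ≤ T) (hμ : μ ∈ T) {x : EuclideanSpace ℝ (Fin n)}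
    (hV : 0 < ‖Tᗮ.starProjection x‖ ^ 2) :
    ‖x‖ ^ 2 * varRatio S μ σ x ≤
      (codimN S : ℝ) * (‖T.starProjection x‖ ^ 2 / ‖Tᗮ.starProjection x‖ ^ 2 + 1) := by
  have h := mul_le_mul_of_nonneg_left (varRatio_le (σ := σ) hST hμ hV) (sq_nonneg ‖x‖)
  refine h.trans_eq ?_
  rw [norm_sq_eq_projection_add T x, div_add_one hV.ne']
  ring

lemma integrable_sq_norm_mul_varRatio (hS : dimD S + 5 ≤ n) (hST : S ≤ T) (hμ : μ ∈ T)
    (hT : Module.finrank ℝ T = dimD S + 1) :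
    Integrable (fun x => ‖x‖ ^ 2 * varRatio S μ σ x)
      (stdGaussian (EuclideanSpace ℝ (Fin n))) := by
  refine (((integrable_augmented_ratio hS hT).add (integrable_const 1)).const_mul
    (codimN S : ℝ)).mono' (by fun_prop) ?_
  filter_upwards [ae_pos_orthogonal_augmented hS hT] with x hx
  rw [Real.norm_eq_abs, abs_of_nonneg (mul_nonneg (sq_nonneg _) (varRatio_nonneg x))]
  exact sq_norm_mul_varRatio_le hST hμ hx

lemma integral_sq_norm_mul_varRatio_le (hS : dimD S + 5 ≤ n) (hST : S ≤ T) (hμ : μ ∈ T)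
    (hT : Module.finrank ℝ T = dimD S + 1) :
    ∫ x, ‖x‖ ^ 2 * varRatio S μ σ x ∂(stdGaussian (EuclideanSpace ℝ (Fin n))) ≤ 5 / 2 * n := by
  have hN := five_le_codimN hS
  have hi := integrable_augmented_ratio hS hT
  have h1 : ∫ x, ‖x‖ ^ 2 * varRatio S μ σ x ∂(stdGaussian (EuclideanSpace ℝ (Fin n))) ≤
      ∫ x, (codimN S : ℝ) * (‖T.starProjection x‖ ^ 2 / ‖Tᗮ.starProjection x‖ ^ 2 + 1)
        ∂(stdGaussian (EuclideanSpace ℝ (Fin n))) := by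
    refine integral_mono_ae (integrable_sq_norm_mul_varRatio hS hST hμ hT)
      ((hi.add (integrable_const 1)).const_mul _) ?_
    filter_upwards [ae_pos_orthogonal_augmented hS hT] with x hx
    exact sq_norm_mul_varRatio_le hST hμ hx
  rw [integral_const_mul, integral_add hi (integrable_const 1), integral_augmented_ratio hS hT,
    integral_const, probReal_univ, one_smul] at h1
  refine h1.trans ?_
  -- The bound is N(n - 2)/(N - 3), and N ≤ 5(N - 3)/2 because N ≥ 5.
  rw [← dimD_add_codimN S, div_add_one (by linarith), mul_div_assoc', div_le_iff₀ (by linarith)]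
  have hD : (0 : ℝ) ≤ dimD S := by positivity
  nlinarith

lemma integrable_sq_norm : Integrable (fun x => ‖x‖ ^ 2)
    (stdGaussian (EuclideanSpace ℝ (Fin n))) :=
  (IsGaussian.memLp_two_id (μ := stdGaussian (EuclideanSpace ℝ (Fin n)))).integrable_norm_pow
    (by norm_num)

lemma integrable_varRatio_mul_inner_bias (hS : dimD S + 5 ≤ n) (hST : S ≤ T) (hμ : μ ∈ T)
    (hT : Module.finrank ℝ T = dimD S + 1) :
    Integrable (fun x => varRatio S μ σ x * inner ℝ (bias S μ σ) x)
      (stdGaussian (EuclideanSpace ℝ (Fin n))) := by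
  refine (((integrable_varRatio (σ := σ) hS hST hμ hT).const_mul (‖bias S μ σ‖ ^ 2)).add
    (integrable_sq_norm_mul_varRatio (σ := σ) hS hST hμ hT)).mono' (by fun_prop)
    (.of_forall fun x => ?_)
  have hy := varRatio_nonneg (S := S) (μ := μ) (σ := σ) x
  rw [norm_mul, Real.norm_eq_abs, abs_of_nonneg hy, Pi.add_apply, ← add_mul, mul_comm]
  refine mul_le_mul_of_nonneg_right ?_ hy
  refine (norm_inner_le_norm _ _).trans ?_
  nlinarith [sq_nonneg (‖bias S μ σ‖ - ‖x‖), sq_nonneg ‖bias S μ σ‖, sq_nonneg ‖x‖]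

lemma measurePreserving_neg_stdGaussian :
    MeasurePreserving (fun x => -x) (stdGaussian (EuclideanSpace ℝ (Fin n)))
      (stdGaussian (EuclideanSpace ℝ (Fin n))) :=
  ⟨by fun_prop, stdGaussian_map (LinearIsometryEquiv.neg ℝ)⟩

/-- The estimator of the variance is positively correlated with the projection of the noise on the
bias. -/
lemma integral_varRatio_mul_inner_bias_nonpos (hS : dimD S + 5 ≤ n) (hST : S ≤ T) (hμ : μ ∈ T)
    (hT : Module.finrank ℝ T = dimD S + 1) :
    ∫ x, varRatio S μ σ x * inner ℝ (bias S μ σ) x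
      ∂(stdGaussian (EuclideanSpace ℝ (Fin n))) ≤ 0 := by
  have hi := integrable_varRatio_mul_inner_bias (σ := σ) hS hST hμ hT
  have hneg := measurePreserving_neg_stdGaussian (n := n)
  have hi2 : Integrable (fun x => varRatio S μ σ (-x) * inner ℝ (bias S μ σ) (-x))
      (stdGaussian (EuclideanSpace ℝ (Fin n))) := hneg.integrable_comp_of_integrable hi
  have he : ∫ x, varRatio S μ σ (-x) * inner ℝ (bias S μ σ) (-x)
      ∂(stdGaussian (EuclideanSpace ℝ (Fin n))) =
      ∫ x, varRatio S μ σ x * inner ℝ (bias S μ σ) x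
        ∂(stdGaussian (EuclideanSpace ℝ (Fin n))) :=
    hneg.integral_comp (Homeomorph.neg _).measurableEmbedding
      (fun x => varRatio S μ σ x * inner ℝ (bias S μ σ) x)
  have hpos := ae_pos_orthogonal_augmented hS hT
  have hsum : ∫ x, (varRatio S μ σ x * inner ℝ (bias S μ σ) x +
      varRatio S μ σ (-x) * inner ℝ (bias S μ σ) (-x))
      ∂(stdGaussian (EuclideanSpace ℝ (Fin n))) ≤ 0 := by
    -- Pair x with -x, which have the same law: the squared residual norms A and B at these points
    -- satisfy B - A = -4c, so the paired integrand is -4Nc²/(AB).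
    refine integral_nonpos_of_ae ?_
    filter_upwards [hpos] with x hx
    have hx' : 0 < ‖Tᗮ.starProjection (-x)‖ ^ 2 := by rwa [map_neg, norm_neg]
    have h1 := norm_sq_orthogonal_augmented_le (σ := σ) hST hμ x
    have h2 := norm_sq_orthogonal_augmented_le (σ := σ) hST hμ (-x)
    have e1 := norm_sq_bias_add_residual (S := S) (μ := μ) (σ := σ) x
    have e2 := norm_sq_bias_add_residual (S := S) (μ := μ) (σ := σ) (-x)
    rw [map_neg, norm_neg, norm_neg, inner_neg_right] at e2
    simp only [Pi.zero_apply, varRatio, inner_neg_right, map_neg] at h2 ⊢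
    rw [norm_neg] at h2
    set c := inner ℝ (bias S μ σ) x
    set A := ‖bias S μ σ + (x - S.starProjection x)‖ ^ 2
    set B := ‖bias S μ σ + (-x - -S.starProjection x)‖ ^ 2
    have hA : 0 < A := hx.trans_le h1
    have hB : 0 < B := hx.trans_le h2
    have e : (codimN S : ℝ) / A * c + codimN S / B * -c =
        codimN S * (c * (B - A)) / (A * B) := by
      field_simp
      ring
    have hAB : c * (B - A) = -(4 * c ^ 2) := by rw [e1, e2]; ring
    rw [e, hAB]
    refine div_nonpos_of_nonpos_of_nonneg ?_ (by positivity)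
    exact mul_nonpos_of_nonneg_of_nonpos (by positivity) (by nlinarith [sq_nonneg c])
  rw [integral_add hi hi2, he] at hsum
  linarith

lemma abs_log_le {y : ℝ} (hy : 0 < y) : |Real.log y| ≤ y + y⁻¹ := by
  have h1 := Real.log_le_sub_one_of_pos hy
  have h2 := Real.log_le_sub_one_of_pos (inv_pos.2 hy)
  have h3 := inv_pos.2 hy
  rw [Real.log_inv] at h2
  exact abs_le.2 ⟨by linarith, by linarith⟩

lemma integrable_kullback (hσ : 0 < σ) (hS : dimD S + 5 ≤ n) :
    Integrable (fun x => kullback (μ, σ ^ 2) (thetaHat S (μ + σ • x)))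
      (stdGaussian (EuclideanSpace ℝ (Fin n))) := by
  obtain ⟨T, hST, hμ, hT⟩ := exists_augmented_model (S := S) μ (by omega)
  have hy := integrable_varRatio (σ := σ) hS hST hμ hT
  have hXy := integrable_sq_norm_mul_varRatio (σ := σ) hS hST hμ hT
  have hN := five_le_codimN hS
  have hlog : Integrable (fun x => Real.log (varRatio S μ σ x))
      (stdGaussian (EuclideanSpace ℝ (Fin n))) := by
    -- The logarithm is dominated by y + 1/y, where 1/y is the squared residual norm over N and
    -- hence at most quadratic in x.
    have hb : Integrable (fun x : EuclideanSpace ℝ (Fin n) => varRatio S μ σ x +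
        (2 * ‖bias S μ σ‖ ^ 2 + 2 * ‖x‖ ^ 2)) (stdGaussian (EuclideanSpace ℝ (Fin n))) :=
      hy.add ((integrable_const _).add (integrable_sq_norm.const_mul 2))
    refine hb.mono' measurable_varRatio.log.aestronglyMeasurable ?_
    filter_upwards [ae_pos_orthogonal_augmented hS hT] with x hx
    refine (abs_log_le (varRatio_pos (by omega) hST hμ hx)).trans ?_
    gcongr
    rw [varRatio, inv_div]
    refine (div_le_self (by positivity) (by linarith)).trans (norm_sq_bias_add_residual_le x)
  have hs : Integrable (fun x => varRatio S μ σ x * ‖S.starProjection x‖ ^ 2)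
      (stdGaussian (EuclideanSpace ℝ (Fin n))) := by
    refine hXy.mono' (by fun_prop) (.of_forall fun x => ?_)
    rw [Real.norm_eq_abs, abs_of_nonneg (mul_nonneg (varRatio_nonneg x) (sq_nonneg _)), mul_comm]
    gcongr
    · exact varRatio_nonneg x
    · exact Submodule.norm_starProjection_apply_le _ _
  have hall : Integrable (fun x =>
      (n : ℝ) / 2 * (-Real.log (varRatio S μ σ x) + varRatio S μ σ x - 1) +
        1 / 2 * (varRatio S μ σ x * ‖bias S μ σ‖ ^ 2 +
          varRatio S μ σ x * ‖S.starProjection x‖ ^ 2))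
      (stdGaussian (EuclideanSpace ℝ (Fin n))) :=
    (((hlog.neg.add hy).sub (integrable_const 1)).const_mul _).add
      (((hy.mul_const _).add hs).const_mul _)
  refine hall.congr (.of_forall fun x => ?_)
  simp only
  rw [kullback_eq hσ (by omega), mul_add (varRatio S μ σ x)]

/-- The excess of the Fisher statistic over the penalty. -/
noncomputable def excess (S T : Submodule ℝ (EuclideanSpace ℝ (Fin n))) (K₁ K₂ p : ℝ)
    (x : EuclideanSpace ℝ (Fin n)) : ℝ :=
  max (K₁ * ‖T.starProjection x‖ ^ 2 * (codimN S / ‖Tᗮ.starProjection x‖ ^ 2) - dimD S -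
    (1 - 1 / K₂) * p) 0

lemma integrable_excess (hS : dimD S + 5 ≤ n) (hT : Module.finrank ℝ T = dimD S + 1)
    (K₁ K₂ p : ℝ) :
    Integrable (excess S T K₁ K₂ p) (stdGaussian (EuclideanSpace ℝ (Fin n))) := by
  have h := ((((integrable_augmented_ratio hS hT).const_mul (K₁ * codimN S)).sub
    (integrable_const (dimD S : ℝ))).sub (integrable_const ((1 - 1 / K₂) * p))).pos_part
  refine h.congr (.of_forall fun x => ?_)
  simp only [excess, Pi.sub_apply]
  congr 3
  ring

lemma integral_excess_le (hS : dimD S + 5 ≤ n) (hT : Module.finrank ℝ T = dimD S + 1)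
    {K₁ K₂ : ℝ} (hK₁ : 0 < K₁) (hK₂ : 0 < K₂) (p : ℝ) :
    ∫ x, excess S T K₁ K₂ p x ∂(stdGaussian (EuclideanSpace ℝ (Fin n))) ≤
      5 / 2 * K₁ * (((dimD S : ℝ) + 1) * Lambda S K₁ K₂ p) := by
  have hN := five_le_codimN hS
  have hD1 : (0 : ℝ) < (dimD S : ℝ) + 1 := by positivity
  have hN1 : (0 : ℝ) < (codimN S : ℝ) - 1 := by linarith
  have hN0 : (0 : ℝ) < (codimN S : ℝ) := by linarith
  -- A converts the ratio of χ² variables into a Fisher variable, and z is the threshold in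
  -- `Lambda`, so that the excess is A (F - z)₊.
  set A : ℝ := K₁ * codimN S * ((dimD S : ℝ) + 1) / ((codimN S : ℝ) - 1) with hA
  have hA0 : 0 < A := by positivity
  set z : ℝ := ((codimN S : ℝ) - 1) / (K₁ * codimN S) *
      ((K₂ * dimD S + (K₂ - 1) * p) / (K₂ * (dimD S + 1))) with hz
  have hAz : A * z = dimD S + (1 - 1 / K₂) * p := by
    rw [hA, hz]
    field_simp
  have e : ∀ x, excess S T K₁ K₂ p x = (fun q : ℝ × ℝ =>
      A * max (q.1 / ((dimD S + 1 : ℕ) : ℝ) / (q.2 / ((codimN S - 1 : ℕ) : ℝ)) - z) 0)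
      (‖T.starProjection x‖ ^ 2, ‖Tᗮ.starProjection x‖ ^ 2) := by
    intro x
    simp only [excess]
    rw [← mul_max_of_nonneg _ _ hA0.le |>.symm, mul_zero, mul_sub, hAz, cast_codimN_sub_one hS]
    congr 1
    rw [← sub_sub]
    congr 2
    rw [hA, div_div_div_eq]
    push_cast
    rw [div_mul_div_comm, ← mul_div_assoc, ← mul_assoc ((codimN S : ℝ) - 1),
      ← mul_div_mul_left _ _ (mul_pos hN1 hD1).ne']
    ring
  simp_rw [e]
  have h1 := integral_map (measurePreserving_augmented hT).aemeasurable
    (f := fun q : ℝ × ℝ =>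
      A * max (q.1 / ((dimD S + 1 : ℕ) : ℝ) / (q.2 / ((codimN S - 1 : ℕ) : ℝ)) - z) 0)
    (Measurable.aestronglyMeasurable (by fun_prop))
  rw [← h1, (measurePreserving_augmented hT).map_eq, integral_const_mul]
  have h2 : ∫ q : ℝ × ℝ, max (q.1 / ((dimD S + 1 : ℕ) : ℝ) / (q.2 / ((codimN S - 1 : ℕ) : ℝ)) - z)
      0 ∂((chiSquared (dimD S + 1)).prod (chiSquared (codimN S - 1))) =
      Lambda S K₁ K₂ p * ∫ t, t ∂(fisherLaw (dimD S + 1) (codimN S - 1)) := by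
    rw [Lambda, Fish, div_mul_cancel₀ _
      (integral_id_fisherLaw_pos (by omega) (three_le_codimN_sub_one hS)).ne']
    conv_rhs => rw [fisherLaw]
    rw [integral_map (by fun_prop) (by fun_prop)]
  rw [h2, integral_id_fisherLaw (by omega) (three_le_codimN_sub_one hS), cast_codimN_sub_one hS]
  have hL : 0 ≤ Lambda S K₁ K₂ p := Fish_nonneg _
  have h3 : A * (Lambda S K₁ K₂ p * (((codimN S : ℝ) - 1) / ((codimN S : ℝ) - 1 - 2))) =
      (codimN S / ((codimN S : ℝ) - 3)) * (K₁ * (((dimD S : ℝ) + 1) * Lambda S K₁ K₂ p)) := by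
    have : (codimN S : ℝ) - 1 - 2 = codimN S - 3 := by ring
    have h4 : (codimN S : ℝ) - 3 ≠ 0 := by linarith
    rw [this, hA]
    field_simp
  rw [h3, mul_assoc (5 / 2)]
  refine mul_le_mul_of_nonneg_right ?_ (by positivity)
  -- The factor N/(N - 3) comes from the Fisher mean (N - 1)/(N - 3) and is at most 5/2 since N ≥ 5.
  rw [div_le_iff₀ (by linarith)]
  linarith

end Expectation

lemma five_le_alphaMin_mul {n : ℕ} {M : Type*} [Nonempty M]
    {S : M → Submodule ℝ (EuclideanSpace ℝ (Fin n))} (hS : ∀ m, dimD (S m) + 5 ≤ n) :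
    5 ≤ alphaMin S * n := by
  have hn : (0 : ℝ) < n := by
    have := hS (Classical.arbitrary M)
    exact_mod_cast (by omega : 0 < n)
  rw [← div_le_iff₀ hn]
  exact le_ciInf fun m => div_le_div_of_nonneg_right (five_le_codimN (hS m)) hn.le

/-! ### The selected model: small noise, pointwise bound and its expectation -/

section Selection

variable {n : ℕ} {M : Type*} [Fintype M] {S T : M → Submodule ℝ (EuclideanSpace ℝ (Fin n))}
  {μ : EuclideanSpace ℝ (Fin n)} {σ : ℝ}

/-- The `ℓᵖ` norm of the family of the ratios `N_m / V_m`. -/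
noncomputable def ratioNorm (S T : M → Submodule ℝ (EuclideanSpace ℝ (Fin n))) (p : ℝ)
    (x : EuclideanSpace ℝ (Fin n)) : ℝ :=
  (∑ m, ((codimN (S m) : ℝ) / ‖(T m)ᗮ.starProjection x‖ ^ 2) ^ p) ^ (1 / p)

lemma ratioNorm_nonneg (p : ℝ) (x : EuclideanSpace ℝ (Fin n)) : 0 ≤ ratioNorm S T p x := by
  unfold ratioNorm
  positivity

lemma measurable_ratioNorm (p : ℝ) : Measurable (ratioNorm S T p) := by
  unfold ratioNorm
  fun_prop

lemma ratio_le_ratioNorm {p : ℝ} (hp : 0 < p) (x : EuclideanSpace ℝ (Fin n)) (m : M) :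
    (codimN (S m) : ℝ) / ‖(T m)ᗮ.starProjection x‖ ^ 2 ≤ ratioNorm S T p x := by
  have h : ((codimN (S m) : ℝ) / ‖(T m)ᗮ.starProjection x‖ ^ 2) ^ p ≤
      ∑ m, ((codimN (S m) : ℝ) / ‖(T m)ᗮ.starProjection x‖ ^ 2) ^ p :=
    Finset.single_le_sum (f := fun m =>
      ((codimN (S m) : ℝ) / ‖(T m)ᗮ.starProjection x‖ ^ 2) ^ p)
      (fun i _ => by positivity) (Finset.mem_univ m)
  have h2 := Real.rpow_le_rpow (by positivity) h (by positivity : 0 ≤ 1 / p)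
  rwa [← Real.rpow_mul (by positivity), mul_one_div_cancel hp.ne', Real.rpow_one] at h2

lemma ratioNorm_rpow {p : ℝ} (hp : 0 < p) (x : EuclideanSpace ℝ (Fin n)) :
    ratioNorm S T p x ^ p = ∑ m, ((codimN (S m) : ℝ) / ‖(T m)ᗮ.starProjection x‖ ^ 2) ^ p := by
  rw [ratioNorm, ← Real.rpow_mul (by positivity), one_div_mul_cancel hp.ne', Real.rpow_one]

lemma integrable_ratioNorm_rpow (hS : ∀ m, dimD (S m) + 5 ≤ n)
    (hT : ∀ m, Module.finrank ℝ (T m) = dimD (S m) + 1) {p : ℝ} (hp1 : 1 ≤ p)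
    (hp : ∀ m, p ≤ (codimN (S m) : ℝ) / 4) :
    Integrable (fun x => ratioNorm S T p x ^ p) (stdGaussian (EuclideanSpace ℝ (Fin n))) := by
  simp_rw [ratioNorm_rpow (by linarith : 0 < p)]
  exact integrable_finsetSum _ fun m _ => integrable_rpow_augmented (hS m) (hT m) (hp m)

lemma integral_ratioNorm_rpow_le (hS : ∀ m, dimD (S m) + 5 ≤ n)
    (hT : ∀ m, Module.finrank ℝ (T m) = dimD (S m) + 1) {p : ℝ} (hp1 : 1 ≤ p)
    (hp : ∀ m, p ≤ (codimN (S m) : ℝ) / 4) :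
    ∫ x, ratioNorm S T p x ^ p ∂(stdGaussian (EuclideanSpace ℝ (Fin n))) ≤
      Fintype.card M * 5 ^ p := by
  simp_rw [ratioNorm_rpow (by linarith : 0 < p)]
  rw [integral_finsetSum _ fun m _ => integrable_rpow_augmented (hS m) (hT m) (hp m)]
  refine (Finset.sum_le_sum fun m _ =>
    integral_rpow_augmented_le (hS m) (hT m) hp1 (hp m)).trans_eq ?_
  simp

lemma memLp_ratioNorm (hS : ∀ m, dimD (S m) + 5 ≤ n)
    (hT : ∀ m, Module.finrank ℝ (T m) = dimD (S m) + 1) {p : ℝ} (hp1 : 1 ≤ p)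
    (hp : ∀ m, p ≤ (codimN (S m) : ℝ) / 4) :
    MemLp (ratioNorm S T p) (ENNReal.ofReal p) (stdGaussian (EuclideanSpace ℝ (Fin n))) := by
  have hp0 : 0 < p := by linarith
  rw [← integrable_norm_rpow_iff (measurable_ratioNorm p).aestronglyMeasurable
    (by simpa using hp0) ENNReal.ofReal_ne_top, ENNReal.toReal_ofReal hp0.le]
  refine (integrable_ratioNorm_rpow hS hT hp1 hp).congr (.of_forall fun x => ?_)
  simp only [Real.norm_eq_abs, abs_of_nonneg (ratioNorm_nonneg p x)]

/-- The contribution of the atypically small noise. -/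
noncomputable def smallNoise (S T : M → Submodule ℝ (EuclideanSpace ℝ (Fin n))) (p K₂ : ℝ)
    (x : EuclideanSpace ℝ (Fin n)) : ℝ :=
  if ‖x‖ ^ 2 ≤ (n : ℝ) * (1 - 1 / K₂) then ratioNorm S T p x else 0

lemma smallNoise_eq_indicator (p K₂ : ℝ) :
    smallNoise S T p K₂ = {x : EuclideanSpace ℝ (Fin n) |
      ‖x‖ ^ 2 ≤ (n : ℝ) * (1 - 1 / K₂)}.indicator (ratioNorm S T p) := by
  ext x
  simp [smallNoise, Set.indicator_apply]

lemma measurableSet_sq_norm_le (a : ℝ) :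
    MeasurableSet {x : EuclideanSpace ℝ (Fin n) | ‖x‖ ^ 2 ≤ a} :=
  measurableSet_le (by fun_prop) measurable_const

lemma integrable_smallNoise (hS : ∀ m, dimD (S m) + 5 ≤ n)
    (hT : ∀ m, Module.finrank ℝ (T m) = dimD (S m) + 1) {p : ℝ} (hp1 : 1 ≤ p)
    (hp : ∀ m, p ≤ (codimN (S m) : ℝ) / 4) (K₂ : ℝ) :
    Integrable (smallNoise S T p K₂) (stdGaussian (EuclideanSpace ℝ (Fin n))) := by
  rw [smallNoise_eq_indicator]
  exact ((memLp_ratioNorm hS hT hp1 hp).integrable (by simpa using hp1)).indicator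
    (measurableSet_sq_norm_le _)

/-- Hölder's inequality between the indicator of the small-noise event and `ratioNorm`, an ℓᵖ norm
that dominates the largest ratio N/V at the cost of only |M|^(1/p). -/
lemma integral_smallNoise_le (hS : ∀ m, dimD (S m) + 5 ≤ n)
    (hT : ∀ m, Module.finrank ℝ (T m) = dimD (S m) + 1) {p : ℝ} (hp1 : 1 < p)
    (hp : ∀ m, p ≤ (codimN (S m) : ℝ) / 4) {K₂ : ℝ} (hK₂ : 0 < K₂) :
    ∫ x, smallNoise S T p K₂ x ∂(stdGaussian (EuclideanSpace ℝ (Fin n))) ≤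
      Real.exp (-(n : ℝ) / (4 * K₂ ^ 2)) ^ (1 - 1 / p) *
        ((Fintype.card M : ℝ) ^ (1 / p) * 5) := by
  have hp0 : 0 < p := by linarith
  have hpq : p.HolderConjugate (p / (p - 1)) := Real.HolderConjugate.conjExponent hp1
  have hq : 1 / (p / (p - 1)) = 1 - 1 / p := by
    have : p - 1 ≠ 0 := by linarith
    field_simp
  have hq0 : 0 < p / (p - 1) := div_pos hp0 (by linarith)
  set A := {x : EuclideanSpace ℝ (Fin n) | ‖x‖ ^ 2 ≤ (n : ℝ) * (1 - 1 / K₂)}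
  have hA : MeasurableSet A := measurableSet_sq_norm_le _
  have h := integral_mul_le_Lp_mul_Lq_of_nonneg hpq
    (.of_forall fun x => ratioNorm_nonneg (S := S) (T := T) p x)
    (.of_forall fun x => Set.indicator_nonneg (fun _ _ => zero_le_one) x)
    (memLp_ratioNorm hS hT hp1.le hp)
    (memLp_indicator_const (ENNReal.ofReal (p / (p - 1))) hA (1 : ℝ)
      (Or.inr (measure_ne_top (stdGaussian (EuclideanSpace ℝ (Fin n))) A)))
  have e1 : ∀ x, ratioNorm S T p x * A.indicator (fun _ => (1 : ℝ)) x = smallNoise S T p K₂ x := by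
    intro x
    by_cases hx : x ∈ A
    · rw [Set.indicator_of_mem hx, mul_one, smallNoise]
      exact (if_pos hx).symm
    · rw [Set.indicator_of_notMem hx, mul_zero, smallNoise]
      exact (if_neg hx).symm
  have e2 : ∀ x, A.indicator (fun _ => (1 : ℝ)) x ^ (p / (p - 1)) =
      A.indicator (fun _ => (1 : ℝ)) x := by
    intro x
    by_cases hx : x ∈ A
    · rw [Set.indicator_of_mem hx, Real.one_rpow]
    · rw [Set.indicator_of_notMem hx, Real.zero_rpow hq0.ne']
  simp_rw [e1, e2, integral_indicator_const _ hA, smul_eq_mul, mul_one, hq] at h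
  refine h.trans ?_
  rw [mul_comm]
  have h1p : 0 ≤ 1 - 1 / p := by rw [sub_nonneg, div_le_one hp0]; exact hp1.le
  have hnn : 0 ≤ ∫ x, ratioNorm S T p x ^ p ∂(stdGaussian (EuclideanSpace ℝ (Fin n))) :=
    integral_nonneg fun x => Real.rpow_nonneg (ratioNorm_nonneg p x) p
  refine mul_le_mul ?_ ?_ (by positivity) (by positivity)
  · refine Real.rpow_le_rpow measureReal_nonneg ?_ h1p
    have h2 := stdGaussian_sq_norm_le (E := EuclideanSpace ℝ (Fin n)) (t := 1 / K₂) (by positivity)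
    rw [finrank_euclideanSpace_fin] at h2
    refine h2.trans_eq ?_
    congr 1
    field_simp
  · have h3 := Real.rpow_le_rpow hnn
      (integral_ratioNorm_rpow_le hS hT hp1.le hp) (by positivity : 0 ≤ 1 / p)
    refine h3.trans_eq ?_
    rw [Real.mul_rpow (by positivity) (by positivity), ← Real.rpow_mul (by positivity),
      mul_one_div_cancel hp0.ne', Real.rpow_one]

lemma alphaMin_mul_le (hn : 0 < n) (m : M) : alphaMin S * n ≤ codimN (S m) := by
  have hn' : (0 : ℝ) < n := by exact_mod_cast hn
  rw [← le_div_iff₀ hn']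
  exact ciInf_le (Set.finite_range _).bddBelow m

lemma integral_smallNoise_le_Sigma1 [Nonempty M] (hS : ∀ m, dimD (S m) + 5 ≤ n)
    (hT : ∀ m, Module.finrank ℝ (T m) = dimD (S m) + 1) {K₂ : ℝ} (hK₂ : 0 < K₂) :
    (n : ℝ) / 2 * ∫ x, smallNoise S T (alphaMin S * n / 4) K₂ x
      ∂(stdGaussian (EuclideanSpace ℝ (Fin n))) ≤ Sigma1 S K₂ := by
  have hn : 0 < n := by
    have := hS (Classical.arbitrary M)
    omega
  have hn' : (0 : ℝ) < n := by exact_mod_cast hn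
  have h5 := five_le_alphaMin_mul hS
  have hα : 0 < alphaMin S := pos_of_mul_pos_left (by linarith) hn'.le
  -- This is the largest p that is at most N/4 for every model; it exceeds 1 because αn ≥ 5. The
  -- exponent 1 - 1/p then costs the factor exp(1/(K₂²α)).
  have h := integral_smallNoise_le hS hT (p := alphaMin S * n / 4) (by linarith)
    (fun m => div_le_div_of_nonneg_right (alphaMin_mul_le hn m) (by norm_num)) hK₂
  refine (mul_le_mul_of_nonneg_left h (by positivity)).trans_eq ?_
  have e1 : 1 / (alphaMin S * n / 4) = 4 / (alphaMin S * n) := by rw [one_div_div]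
  have e2 : Real.exp (-(n : ℝ) / (4 * K₂ ^ 2)) ^ (1 - 4 / (alphaMin S * n)) =
      Real.exp (1 / (K₂ ^ 2 * alphaMin S)) * Real.exp (-(n : ℝ) / (4 * K₂ ^ 2)) := by
    rw [← Real.exp_mul, ← Real.exp_add]
    congr 1
    field_simp
    ring
  rw [e1, e2, Sigma1]
  ring

/-- The bound on the loss of the selected model, as a function of the noise. -/
noncomputable def lossBound (S T : M → Submodule ℝ (EuclideanSpace ℝ (Fin n)))
    (μ : EuclideanSpace ℝ (Fin n)) (σ K₁ K₂ : ℝ) (pen : M → ℝ) (m : M)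
    (x : EuclideanSpace ℝ (Fin n)) : ℝ :=
  kullback (μ, σ ^ 2) (thetaHat (S m) (μ + σ • x)) +
    1 / 2 * (dimD (S m) + (1 - 1 / K₂) * pen m) +
    1 / 2 * ∑ k, excess (S k) (T k) K₁ K₂ (pen k) x +
    varRatio (S m) μ σ x * inner ℝ (bias (S m) μ σ) x +
    1 / 2 * (pen m * (‖x‖ ^ 2 * varRatio (S m) μ σ x / n)) +
    n / 2 * smallNoise S T (alphaMin S * n / 4) K₂ x

lemma integrable_lossBound [Nonempty M] (hσ : 0 < σ) (hS : ∀ m, dimD (S m) + 5 ≤ n)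
    (hST : ∀ m, S m ≤ T m) (hμ : ∀ m, μ ∈ T m)
    (hT : ∀ m, Module.finrank ℝ (T m) = dimD (S m) + 1) (K₁ K₂ : ℝ) (pen : M → ℝ) (m : M) :
    Integrable (lossBound S T μ σ K₁ K₂ pen m) (stdGaussian (EuclideanSpace ℝ (Fin n))) := by
  have h5 := five_le_alphaMin_mul hS
  refine (((((integrable_kullback hσ (hS m)).add (integrable_const _)).add ?_).add
    (integrable_varRatio_mul_inner_bias (hS m) (hST m) (hμ m) (hT m))).add ?_).add ?_
  · exact (integrable_finsetSum _ fun k _ => integrable_excess (hS k) (hT k) _ _ _).const_mul _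
  · exact (((integrable_sq_norm_mul_varRatio (hS m) (hST m) (hμ m) (hT m)).div_const
      _).const_mul _).const_mul _
  · exact (integrable_smallNoise hS hT (by linarith) (fun k => div_le_div_of_nonneg_right
      (alphaMin_mul_le (by have := hS m; omega) k) (by norm_num)) K₂).const_mul _

lemma integral_lossBound_le [Nonempty M] (hσ : 0 < σ) (hS : ∀ m, dimD (S m) + 5 ≤ n)
    (hST : ∀ m, S m ≤ T m) (hμ : ∀ m, μ ∈ T m)
    (hT : ∀ m, Module.finrank ℝ (T m) = dimD (S m) + 1) {K₁ K₂ : ℝ} (hK₁ : 0 < K₁)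
    (hK₂ : 0 < K₂) {pen : M → ℝ} (hpen : ∀ m, 0 ≤ pen m) (m : M) :
    ∫ x, lossBound S T μ σ K₁ K₂ pen m x ∂(stdGaussian (EuclideanSpace ℝ (Fin n))) ≤
      ∫ x, kullback (μ, σ ^ 2) (thetaHat (S m) (μ + σ • x))
          ∂(stdGaussian (EuclideanSpace ℝ (Fin n))) +
        9 / 4 * max (pen m) (dimD (S m)) + Sigma1 S K₂ + Sigma2 S K₁ K₂ pen := by
  have h5 := five_le_alphaMin_mul hS
  have hn : (0 : ℝ) < n := by
    have := hS m
    exact_mod_cast (by omega : 0 < n)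
  have i1 := integrable_kullback (μ := μ) hσ (hS m)
  have i2 : Integrable (fun _ => 1 / 2 * ((dimD (S m) : ℝ) + (1 - 1 / K₂) * pen m))
      (stdGaussian (EuclideanSpace ℝ (Fin n))) := integrable_const _
  have i3' : ∀ k ∈ Finset.univ, Integrable (excess (S k) (T k) K₁ K₂ (pen k))
      (stdGaussian (EuclideanSpace ℝ (Fin n))) :=
    fun k _ => integrable_excess (hS k) (hT k) _ _ _
  have i3 : Integrable (fun x => 1 / 2 * ∑ k, excess (S k) (T k) K₁ K₂ (pen k) x)
      (stdGaussian (EuclideanSpace ℝ (Fin n))) := (integrable_finsetSum _ i3').const_mul _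
  have i4 := integrable_varRatio_mul_inner_bias (σ := σ) (hS m) (hST m) (hμ m) (hT m)
  have i5 : Integrable (fun x => 1 / 2 * (pen m * (‖x‖ ^ 2 * varRatio (S m) μ σ x / n)))
      (stdGaussian (EuclideanSpace ℝ (Fin n))) :=
    (((integrable_sq_norm_mul_varRatio (hS m) (hST m) (hμ m) (hT m)).div_const
      _).const_mul _).const_mul _
  have i6 : Integrable (fun x => n / 2 * smallNoise S T (alphaMin S * n / 4) K₂ x)
      (stdGaussian (EuclideanSpace ℝ (Fin n))) :=
    (integrable_smallNoise hS hT (by linarith) (fun k => div_le_div_of_nonneg_right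
      (alphaMin_mul_le (by have := hS m; omega) k) (by norm_num)) K₂).const_mul _
  unfold lossBound
  rw [integral_add ((((i1.fun_add i2).fun_add i3).fun_add i4).fun_add i5) i6,
    integral_add (((i1.fun_add i2).fun_add i3).fun_add i4) i5, integral_add ((i1.fun_add i2).fun_add i3) i4,
    integral_add (i1.fun_add i2) i3, integral_add i1 i2, integral_const, probReal_univ, one_smul,
    integral_const_mul, integral_const_mul, integral_const_mul, integral_const_mul,
    integral_div, integral_finsetSum _ i3']
  have b3 : 1 / 2 * ∑ k, ∫ x, excess (S k) (T k) K₁ K₂ (pen k) x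
      ∂(stdGaussian (EuclideanSpace ℝ (Fin n))) ≤ Sigma2 S K₁ K₂ pen := by
    have h := Finset.sum_le_sum fun k (_ : k ∈ Finset.univ) =>
      integral_excess_le (hS k) (hT k) hK₁ hK₂ (pen k)
    rw [← Finset.mul_sum] at h
    rw [Sigma2]
    linarith
  have b4 := integral_varRatio_mul_inner_bias_nonpos (σ := σ) (hS m) (hST m) (hμ m) (hT m)
  have b5 : pen m * ((∫ x, ‖x‖ ^ 2 * varRatio (S m) μ σ x
      ∂(stdGaussian (EuclideanSpace ℝ (Fin n)))) / n) ≤ pen m * (5 / 2) := by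
    refine mul_le_mul_of_nonneg_left ?_ (hpen m)
    rw [div_le_iff₀ hn]
    exact integral_sq_norm_mul_varRatio_le (hS m) (hST m) (hμ m) (hT m)
  have b6 := integral_smallNoise_le_Sigma1 hS hT hK₂
  -- The constant is 9/4 = 1/2 + 1/2 + 5/4: from D/2, from (1 - 1/K₂) pen/2 ≤ pen/2, and from half
  -- of the bound 5/2 in `b5`.
  have c1 := le_max_left (pen m) (dimD (S m) : ℝ)
  have c2 := le_max_right (pen m) (dimD (S m) : ℝ)
  have c3 : (1 - 1 / K₂) * pen m ≤ pen m := by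
    have : 0 ≤ 1 / K₂ * pen m := mul_nonneg (by positivity) (hpen m)
    linarith
  linarith

/-- The pointwise comparison of the loss of a minimizer `k` of the criterion with the loss of any
other model. -/
lemma kullback_le_lossBound [Nonempty M] (hσ : 0 < σ) (hS : ∀ m, dimD (S m) + 5 ≤ n)
    (hST : ∀ m, S m ≤ T m) (hμ : ∀ m, μ ∈ T m) {K₁ K₂ : ℝ} (hK₁ : 1 < K₁)
    (hK₂ : K₁ ≤ K₂) {pen : M → ℝ} (hpen : ∀ m, 0 ≤ pen m) (m k : M)
    {x : EuclideanSpace ℝ (Fin n)} (hx : ∀ m, 0 < ‖(T m)ᗮ.starProjection x‖ ^ 2)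
    (hcrit : critK (S k) (pen k) (μ + σ • x) ≤ critK (S m) (pen m) (μ + σ • x)) :
    (1 - 1 / K₁) * kullback (μ, σ ^ 2) (thetaHat (S k) (μ + σ • x)) ≤
      lossBound S T μ σ K₁ K₂ pen m x := by
  have hn : 0 < n := by have := hS m; omega
  have h5 := five_le_alphaMin_mul hS
  have hy : ∀ m, 0 < varRatio (S m) μ σ x := fun m =>
    varRatio_pos (by have := hS m; omega) (hST m) (hμ m) (hx m)
  rw [critK_eq hσ _ (hy k), critK_eq hσ _ (hy m)] at hcrit
  have h := loss_comparison (n := n) (X := ‖x‖ ^ 2) (by exact_mod_cast hn) (by positivity) hK₁ hK₂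
    (hy m) (varRatio_mul (hy m)) (dimD_add_codimN (S m)) (by positivity) (hpen m)
    (hy k) (varRatio_mul (hy k)) (dimD_add_codimN (S k)) (hpen k)
    (two_mul_cross_term_le (hST k) (hμ k) (by linarith) x) (by linarith)
  rw [← kullback_eq hσ hn, ← kullback_eq hσ hn] at h
  refine h.trans ?_
  have hle := varRatio_le (σ := σ) (hST k) (hμ k) (hx k)
  have h1 : K₁ * ‖(T k).starProjection x‖ ^ 2 * varRatio (S k) μ σ x - dimD (S k) -
      (1 - 1 / K₂) * pen k ≤ ∑ k, excess (S k) (T k) K₁ K₂ (pen k) x := by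
    -- The index k will be random, so its excess is bounded by the sum over all models, made of
    -- nonnegative terms.
    refine le_trans ?_ (Finset.single_le_sum
      (f := fun k => excess (S k) (T k) K₁ K₂ (pen k) x) (fun i _ => le_max_right _ _)
      (Finset.mem_univ k))
    refine le_trans ?_ (le_max_left _ _)
    gcongr
  have h2 : (if ‖x‖ ^ 2 ≤ (n : ℝ) * (1 - 1 / K₂) then varRatio (S k) μ σ x else 0) ≤
      smallNoise S T (alphaMin S * n / 4) K₂ x := by
    unfold smallNoise
    split_ifs with hX
    · exact hle.trans (ratio_le_ratioNorm (by linarith) x k)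
    · exact le_rfl
  unfold lossBound
  gcongr

/-- With this penalty the argument of `Fish` in `Lambda` is (D + (Ae - D)₊)/A ≥ e, where e is the
`EFish` value; conclude since `Fish` is antitone. -/
lemma Lambda_penK_le {S : Submodule ℝ (EuclideanSpace ℝ (Fin n))} (hS : dimD S + 5 ≤ n)
    {K₁ K₂ L : ℝ} (hK₁ : 1 < K₁) (hK₂ : K₁ ≤ K₂) (hL : 0 ≤ L) :
    Lambda S K₁ K₂ (penK S K₁ K₂ L) ≤ Real.exp (-L) := by
  have hN := five_le_codimN hS
  have hD1 : (0 : ℝ) < (dimD S : ℝ) + 1 := by positivity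
  have hN1 : (0 : ℝ) < (codimN S : ℝ) - 1 := by linarith
  have hN0 : (0 : ℝ) < (codimN S : ℝ) := by linarith
  have hK₂1 : 0 < K₂ - 1 := by linarith
  have hK₂0 : 0 < K₂ := by linarith
  have hK₁0 : 0 < K₁ := by linarith
  have hF := Fish_EFish (D := dimD S + 1) (N := codimN S - 1) (by omega)
    (three_le_codimN_sub_one hS) (Real.exp_pos (-L)) (by simpa using hL)
  refine le_trans ?_ hF.le
  refine Fish_antitone (by omega) (three_le_codimN_sub_one hS) ?_
  set e := EFish (dimD S + 1) (codimN S - 1) (Real.exp (-L))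
  rw [penK]
  set A := K₁ * (dimD S + 1) * codimN S / ((codimN S : ℝ) - 1) with hA
  have hA0 : 0 < A := by positivity
  have h1 : A * e ≤ dimD S + max (A * e - dimD S) 0 := by
    linarith [le_max_left (A * e - dimD S) 0]
  have h2 : ((codimN S : ℝ) - 1) / (K₁ * codimN S) *
      ((K₂ * dimD S + (K₂ - 1) * (K₂ / (K₂ - 1) * max (A * e - dimD S) 0)) /
        (K₂ * (dimD S + 1))) = (dimD S + max (A * e - dimD S) 0) / A := by
    generalize max (A * e - dimD S) 0 = z
    rw [hA]
    field_simp
  rw [h2, le_div_iff₀ hA0, mul_comm]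
  exact h1

end Selection

/-- A vector of independent standard Gaussian variables has the standard Gaussian law. -/
lemma hasLaw_noise {Ω : Type*} [MeasurableSpace Ω] {P : Measure Ω} [IsProbabilityMeasure P]
    {n : ℕ} {ε : Fin n → Ω → ℝ} (hε_indep : iIndepFun ε P)
    (hε_law : ∀ i, HasLaw (ε i) (gaussianReal 0 1) P) :
    HasLaw (fun ω => WithLp.toLp 2 (fun i => ε i ω))
      (stdGaussian (EuclideanSpace ℝ (Fin n))) P := by
  have hm : AEMeasurable (fun ω i => ε i ω) P :=
    aemeasurable_pi_lambda _ fun i => (hε_law i).aemeasurable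
  refine ⟨by fun_prop, ?_⟩
  have h := (iIndepFun_iff_map_fun_eq_pi_map fun i => (hε_law i).aemeasurable).1 hε_indep
  simp_rw [fun i => (hε_law i).map_eq] at h
  rw [← map_pi_eq_stdGaussian, ← h, AEMeasurable.map_map_of_aemeasurable (by fun_prop) hm]
  rfl

end KullbackSelection

/-! ### Transfer from the noise law to the observation, and conclusion -/

theorem theorem3 {Ω : Type*} [MeasurableSpace Ω] (P : Measure Ω) [IsProbabilityMeasure P]
    {n : ℕ} (μ : EuclideanSpace ℝ (Fin n)) (σ : ℝ) (hσ : 0 < σ)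
    -- the observation `Y_i = μ_i + σ ε_i` with i.i.d. standard Gaussian `ε_i`
    (ε : Fin n → Ω → ℝ) (hε_indep : iIndepFun ε P)
    (hε_law : ∀ i, HasLaw (ε i) (gaussianReal 0 1) P)
    (Y : Ω → EuclideanSpace ℝ (Fin n)) (hY : ∀ ω i, Y ω i = μ i + σ * ε i ω)
    -- the finite collection of models
    {M : Type*} [Fintype M] [Nonempty M]
    (S : M → Submodule ℝ (EuclideanSpace ℝ (Fin n)))
    (hD : ∀ m, KullbackSelection.dimD (S m) + 5 ≤ n)
    (K₁ K₂ : ℝ) (hK₁ : 1 < K₁) (hK₂ : K₁ ≤ K₂)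
    (pen : M → ℝ) (hpen : ∀ m, 0 ≤ pen m)
    -- the selected index, a (measurable) almost sure minimizer of the criterion
    (mhat : Ω → M) (hmhat_meas : ∀ m, MeasurableSet (mhat ⁻¹' {m}))
    (hmhat : ∀ᵐ ω ∂P, ∀ m, KullbackSelection.critK (S (mhat ω)) (pen (mhat ω)) (Y ω) ≤
      KullbackSelection.critK (S m) (pen m) (Y ω)) :
    (∀ m, Integrable (fun ω => KullbackSelection.kullback (μ, σ ^ 2)
      (KullbackSelection.thetaHat (S m) (Y ω))) P) ∧
    Integrable (fun ω => KullbackSelection.kullback (μ, σ ^ 2)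
      (KullbackSelection.thetaHat (S (mhat ω)) (Y ω))) P ∧
    (∫ ω, KullbackSelection.kullback (μ, σ ^ 2)
        (KullbackSelection.thetaHat (S (mhat ω)) (Y ω)) ∂P ≤
      K₁ / (K₁ - 1) *
        ((⨅ m, ((∫ ω, KullbackSelection.kullback (μ, σ ^ 2)
              (KullbackSelection.thetaHat (S m) (Y ω)) ∂P) +
            9 / 4 * max (pen m) (KullbackSelection.dimD (S m) : ℝ))) +
          KullbackSelection.Sigma1 S K₂ + KullbackSelection.Sigma2 S K₁ K₂ pen)) ∧
    (∀ L : M → ℝ, (∀ m, 0 ≤ L m) →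
      (∀ m, pen m = KullbackSelection.penK (S m) K₁ K₂ (L m)) →
      KullbackSelection.Sigma2 S K₁ K₂ pen ≤
        1.25 * K₁ * ∑ m, ((KullbackSelection.dimD (S m) : ℝ) + 1) * Real.exp (-L m)) := by
  classical
  choose T hST hμT hT using fun m => KullbackSelection.exists_augmented_model (S := S m) μ
    (by have := hD m; omega)
  have hlaw := KullbackSelection.hasLaw_noise hε_indep hε_law
  set ξ : Ω → EuclideanSpace ℝ (Fin n) := fun ω => WithLp.toLp 2 (fun i => ε i ω)
  have hYξ : ∀ ω, Y ω = μ + σ • ξ ω := by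
    intro ω
    ext i
    simp [hY, ξ]
  have hKint : ∀ m, Integrable (fun ω => KullbackSelection.kullback (μ, σ ^ 2)
      (KullbackSelection.thetaHat (S m) (Y ω))) P := by
    intro m
    simp_rw [hYξ]
    have h := KullbackSelection.integrable_kullback (μ := μ) hσ (hD m)
    rw [← hlaw.map_eq] at h
    exact h.comp_aemeasurable hlaw.aemeasurable
  -- Splitting along the finitely many measurable events on which the index is constant reduces
  -- integrability of the selected loss to that of the fixed models.
  have hsel : (fun ω => KullbackSelection.kullback (μ, σ ^ 2)
      (KullbackSelection.thetaHat (S (mhat ω)) (Y ω))) = fun ω => ∑ m,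
        (mhat ⁻¹' {m}).indicator (fun ω => KullbackSelection.kullback (μ, σ ^ 2)
          (KullbackSelection.thetaHat (S m) (Y ω))) ω := by
    ext ω
    rw [Finset.sum_eq_single (mhat ω)]
    · rw [Set.indicator_of_mem (by simp)]
    · intro m _ hm
      exact Set.indicator_of_notMem (by simpa using hm.symm) _
    · simp
  have hKint' : Integrable (fun ω => KullbackSelection.kullback (μ, σ ^ 2)
      (KullbackSelection.thetaHat (S (mhat ω)) (Y ω))) P := by
    rw [hsel]
    exact integrable_finsetSum _ fun m _ => (hKint m).indicator (hmhat_meas m)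
  have hK₁0 : 0 < K₁ := by linarith
  have hK₂0 : 0 < K₂ := by linarith
  refine ⟨hKint, hKint', ?_, ?_⟩
  · have hpos : ∀ᵐ ω ∂P, ∀ m, 0 < ‖(T m)ᗮ.starProjection (ξ ω)‖ ^ 2 := by
      rw [ae_all_iff]
      intro m
      have h := KullbackSelection.ae_pos_orthogonal_augmented (hD m) (hT m)
      rw [← hlaw.map_eq] at h
      exact ae_of_ae_map hlaw.aemeasurable h
    have hbound : ∀ m, (1 - 1 / K₁) * ∫ ω, KullbackSelection.kullback (μ, σ ^ 2)
        (KullbackSelection.thetaHat (S (mhat ω)) (Y ω)) ∂P ≤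
        (∫ ω, KullbackSelection.kullback (μ, σ ^ 2)
          (KullbackSelection.thetaHat (S m) (Y ω)) ∂P) +
          9 / 4 * max (pen m) (KullbackSelection.dimD (S m) : ℝ) +
          KullbackSelection.Sigma1 S K₂ + KullbackSelection.Sigma2 S K₁ K₂ pen := by
      intro m
      have hB := KullbackSelection.integrable_lossBound hσ hD hST hμT hT K₁ K₂ pen m
      have hBi : ∫ ω, KullbackSelection.lossBound S T μ σ K₁ K₂ pen m (ξ ω) ∂P =
          ∫ x, KullbackSelection.lossBound S T μ σ K₁ K₂ pen m x
            ∂(stdGaussian (EuclideanSpace ℝ (Fin n))) :=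
        hlaw.integral_comp hB.aestronglyMeasurable
      have hKi : ∫ ω, KullbackSelection.kullback (μ, σ ^ 2)
            (KullbackSelection.thetaHat (S m) (μ + σ • ξ ω)) ∂P =
          ∫ x, KullbackSelection.kullback (μ, σ ^ 2)
            (KullbackSelection.thetaHat (S m) (μ + σ • x))
            ∂(stdGaussian (EuclideanSpace ℝ (Fin n))) :=
        hlaw.integral_comp
          (KullbackSelection.integrable_kullback (μ := μ) hσ (hD m)).aestronglyMeasurable
      have hB' := hB
      rw [← hlaw.map_eq] at hB'
      simp_rw [hYξ] at hKint' hmhat ⊢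
      rw [← integral_const_mul, hKi]
      refine le_trans ?_ (KullbackSelection.integral_lossBound_le hσ hD hST hμT hT hK₁0 hK₂0
        hpen m)
      rw [← hBi]
      refine integral_mono_ae (hKint'.const_mul _) (hB'.comp_aemeasurable hlaw.aemeasurable) ?_
      filter_upwards [hpos, hmhat] with ω h1 h2
      exact KullbackSelection.kullback_le_lossBound hσ hD hST hμT hK₁ hK₂ hpen m (mhat ω) h1
        (h2 m)
    -- Only the fixed-model loss and the 9/4 term depend on m; the residual terms are moved to the
    -- other side before taking the infimum.
    have hinf := le_ciInf fun m => sub_le_iff_le_add.2 (sub_le_iff_le_add.2 (hbound m))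
    have hK : 0 < (K₁ - 1) / K₁ := div_pos (by linarith) hK₁0
    have e1 : 1 - 1 / K₁ = (K₁ - 1) / K₁ := by field_simp
    rw [e1] at hinf
    rw [← inv_div (K₁ - 1) K₁, ← div_eq_inv_mul, le_div_iff₀ hK, mul_comm]
    linarith
  · intro L hL hpenL
    rw [KullbackSelection.Sigma2]
    have h : ∑ m, ((KullbackSelection.dimD (S m) : ℝ) + 1) *
        KullbackSelection.Lambda (S m) K₁ K₂ (pen m) ≤
        ∑ m, ((KullbackSelection.dimD (S m) : ℝ) + 1) * Real.exp (-L m) := by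
      refine Finset.sum_le_sum fun m _ => mul_le_mul_of_nonneg_left ?_ (by positivity)
      rw [hpenL m]
      exact KullbackSelection.Lambda_penK_le (hD m) hK₁ hK₂ (hL m)
    have e : 5 * K₁ / 4 = 1.25 * K₁ := by norm_num; ring
    rw [e]
    exact mul_le_mul_of_nonneg_left h (by positivity)
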